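/- Let $\mathbb F=\mathbb R$ or $\mathbb C$ and let $(\mathbb X,\|\cdot\|)$ be a quasi-Banach space over $\mathbb F$, i.e. a vector space with a quasi-norm ($\|x\|\ge 0$; $\|x\|=0$ iff $x=0$; $\|tx\|=|t|\|x\|$; $\|x+y\|\le\kappa(\|x\|+\|y\|)$ for some constant $\kappa\ge1$) for which it is complete. Let $\mathcal B=(e_n)_{n\ge1}$ be a semi-normalized Markushevich basis (M-basis) of $\mathbb X$: there are functionals $e_n^*\in\mathbb X^*$ with $e_i^*(e_j)=\delta_{ij}$; there are $c_1,c_2>0$ with $c_1\le\|e_n\|,\|e_n^*\|_*\le c_2$ for all $n$, where $\|f\|_*=\sup_{\|x\|\le 1}|f(x)|$; the span of $(e_n)$ is dense in $\mathbb X$; and $e_n^*(x)=0$ for all $n$ implies $x=0$. Throughout, $m,n,k,M$ denote positive integers. A greedy ordering of $x$ is an injective map $\pi:\mathbb N\to\mathbb N$ with $\{n:e_n^*(x)\ne0\}\subset\pi(\mathbb N)$ and $|e^*_{\pi(i)}(x)|\ge|e^*_{\pi(j)}(x)|$ whenever $i\le j$. Put $$\gamma_m(x)=\sup_\pi\Big\|x-\sum_{i=1}^m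 e^*_{\pi(i)}(x)e_{\pi(i)}\Big\|,\qquad \vartheta_m(x)=\sup_\pi\inf_{a_1,\dots,a_m\in\mathbb F}\Big\|x-\sum_{i=1}^m a_ie_{\pi(i)}\Big\|,$$ the suprema being over all greedy orderings $\pi$ of $x$, and $$\sigma_m(x)=\inf\Big\{\Big\|x-\sum_{n\in A}b_ne_n\Big\|:A\subset\mathbb N,\ |A|=m,\ b_n\in\mathbb F\Big\}.$$ The basis $\mathcal B$ is quasi-greedy if there is $C>0$ with $\gamma_m(x)\le C\|x\|$ for all $x,m$; semi-greedy if there is $C>0$ with $\vartheta_m(x)\le C\sigma_m(x)$ for all $x,m$; Schauder if there is $C>0$ with $\|\sum_{n=1}^m e_n^*(x)e_n\|\le C\|x\|$ for all $x,m$. For finite $A\subset\mathbb N$ and scalars $\varepsilon=(\varepsilon_n)_{n\in A}$ of modulus one (written $|\varepsilon|=1$) let $1_{\varepsilon A}=\sum_{n\in A}\varepsilon_ne_n$, and let $h_r(n)=\sup\{\|1_{\varepsilon A}\|:|A|\le n,\ |\varepsilon|=1\}$. The basis has Property (W) if there is $C>0$ such that for all $n$ and all $m\ge n$ there are $A\subset\{m+1,m+2,\dots\}$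 with $|A|=n$ and $|\varepsilon|=1$ such that $h_r(n)\le C\|1_{\varepsilon A}\|$. Let $\omega=(\omega(n))_{n\ge1}$ be a doubling weight: $0<\omega(1)\le\omega(2)\le\cdots$, $\lim_n\omega(n)=\infty$, and $\omega(2n)\le\theta\,\omega(n)$ for all $n$ and some constant $\theta\ge1$. Assume that its lower dilation index $$i_\omega=\sup_{M>1}\frac{\ln\varphi_\omega(M)}{\ln M},\qquad \varphi_\omega(M)=\inf_{k\ge1}\frac{\omega(Mk)}{\omega(k)},$$ is positive. For $0<q<\infty$ let $$\|x\|_{\mathcal A_q^\omega}=\|x\|+\Big[\sum_{n=1}^\infty(\omega(n)\sigma_n(x))^q\frac1n\Big]^{1/q},\qquad \|x\|_{\mathcal A_\infty^\omega}=\|x\|+\sup_{n\ge1}\omega(n)\sigma_n(x),$$ and $\mathcal A_q^\omega=\{x\in\mathbb X:\|x\|_{\mathcal A_q^\omega}<\infty\}$ for $0<q\le\infty$; the class $\mathcal{CG}_q^\omega$ and $\|\cdot\|_{\mathcal{CG}_q^\omega}$ are defined in the same way with $\vartheta_n$ in place of $\sigma_n$. For two such classes, $Y\hookrightarrow Z$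 means that $Y\subset Z$ and there is $C>0$ with $\|x\|_Z\le C\|x\|_Y$ for all $x\in Y$; and $Y\approx Z$ means $Y\hookrightarrow Z$ and $Z\hookrightarrow Y$. **Theorem.** Let $\omega$ be a doubling weight with $i_\omega>0$ and let $\mathcal B$ be a quasi-greedy M-basis of a quasi-Banach space $\mathbb X$. 1. If $\mathcal B$ is semi-greedy, then $\mathcal A_q^\omega\approx\mathcal{CG}_q^\omega$ for all $q\in(0,\infty]$. 2. If $\mathcal B$ is Schauder with Property (W) and $\mathcal A_q^\omega\approx\mathcal{CG}_q^\omega$ for some $q\in(0,\infty]$, then $\mathcal B$ is semi-greedy. -/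

import Mathlib

open scoped ENNReal

noncomputable section

/-- `N` is a quasi-norm on the `𝕜`-vector space `X` for which `X` is complete, i.e. `(X, N)` is a
quasi-Banach space. Completeness is with respect to the (metrizable) vector topology given by the
sets `{x | N x < r}`, so it is stated with sequences. -/
structure IsQuasiBanach (𝕜 : Type*) {X : Type*} [RCLike 𝕜] [AddCommGroup X] [Module 𝕜 X]
    (N : X → ℝ) : Prop where
  nonneg : ∀ x, 0 ≤ N x
  eq_zero_iff : ∀ x, N x = 0 ↔ x = 0
  smul : ∀ (t : 𝕜) (x : X), N (t • x) = ‖t‖ * N x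
  add_le : ∃ κ : ℝ, 1 ≤ κ ∧ ∀ x y, N (x + y) ≤ κ * (N x + N y)
  complete : ∀ u : ℕ → X,
    (∀ ε : ℝ, 0 < ε → ∃ n₀ : ℕ, ∀ m, n₀ ≤ m → ∀ n, n₀ ≤ n → N (u m - u n) < ε) →
    ∃ x : X, Filter.Tendsto (fun n => N (u n - x)) Filter.atTop (nhds 0)

/-- The norm `‖f‖_* = sup {|f x| : N x ≤ 1}` of a linear functional; it is finite exactly when `f`
is continuous. -/
def dualQNorm {𝕜 X : Type*} [RCLike 𝕜] [AddCommGroup X] [Module 𝕜 X]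
    (N : X → ℝ) (f : X →ₗ[𝕜] 𝕜) : ℝ≥0∞ :=
  ⨆ (x : X) (_ : N x ≤ 1), ENNReal.ofReal ‖f x‖

/-- `(e n)` is a semi-normalized Markushevich basis with biorthogonal functionals `(es n)`.
Basis vectors are numbered from `0`: `e n` is the `(n+1)`-st vector of the basis. -/
structure IsMBasis {𝕜 X : Type*} [RCLike 𝕜] [AddCommGroup X] [Module 𝕜 X]
    (N : X → ℝ) (e : ℕ → X) (es : ℕ → X →ₗ[𝕜] 𝕜) : Prop where
  biorthogonal : ∀ i j, es i (e j) = if i = j then 1 else 0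
  seminormalized : ∃ c₁ c₂ : ℝ, 0 < c₁ ∧ ∀ n,
    (c₁ ≤ N (e n) ∧ N (e n) ≤ c₂) ∧
    (ENNReal.ofReal c₁ ≤ dualQNorm N (es n) ∧ dualQNorm N (es n) ≤ ENNReal.ofReal c₂)
  dense_span : ∀ (x : X) (ε : ℝ), 0 < ε →
    ∃ y ∈ Submodule.span 𝕜 (Set.range e), N (x - y) < ε
  total : ∀ x : X, (∀ n, es n x = 0) → x = 0

/-- `S_m x`, the sum of the first `m` terms of the expansion of `x`. -/
def basisPartialSum {𝕜 X : Type*} [RCLike 𝕜] [AddCommGroup X] [Module 𝕜 X]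
    (e : ℕ → X) (es : ℕ → X →ₗ[𝕜] 𝕜) (m : ℕ) (x : X) : X :=
  ∑ n ∈ Finset.range m, es n x • e n

/-- The additional requirement for an M-basis to be a Schauder basis. -/
def IsSchauder {𝕜 X : Type*} [RCLike 𝕜] [AddCommGroup X] [Module 𝕜 X]
    (N : X → ℝ) (e : ℕ → X) (es : ℕ → X →ₗ[𝕜] 𝕜) : Prop :=
  ∃ C : ℝ, 0 < C ∧ ∀ (m : ℕ) (x : X), 1 ≤ m → N (basisPartialSum e es m x) ≤ C * N x

/-- `π` is a greedy ordering of `x`. (It need not be onto: indices outside the support of `x` may be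
left out, as they must be if `x` has infinite support that is not everything.) -/
structure IsGreedyOrdering {𝕜 X : Type*} [RCLike 𝕜] [AddCommGroup X] [Module 𝕜 X]
    (es : ℕ → X →ₗ[𝕜] 𝕜) (x : X) (π : ℕ → ℕ) : Prop where
  injective : Function.Injective π
  support_subset : {n | es n x ≠ 0} ⊆ Set.range π
  decreasing : ∀ i j, i ≤ j → ‖es (π j) x‖ ≤ ‖es (π i) x‖

/-- `G_m^π x`, the greedy sum of `x` of order `m` for the ordering `π`. -/
def greedySum {𝕜 X : Type*} [RCLike 𝕜] [AddCommGroup X] [Module 𝕜 X]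
    (e : ℕ → X) (es : ℕ → X →ₗ[𝕜] 𝕜) (π : ℕ → ℕ) (m : ℕ) (x : X) : X :=
  ∑ i ∈ Finset.range m, es (π i) x • e (π i)

/-- The greedy error `γ_m(x) = sup_π ‖x - G_m^π x‖`. -/
def greedyError {𝕜 X : Type*} [RCLike 𝕜] [AddCommGroup X] [Module 𝕜 X]
    (N : X → ℝ) (e : ℕ → X) (es : ℕ → X →ₗ[𝕜] 𝕜) (m : ℕ) (x : X) : ℝ≥0∞ :=
  ⨆ (π : ℕ → ℕ) (_ : IsGreedyOrdering es x π), ENNReal.ofReal (N (x - greedySum e es π m x))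

/-- The Chebyshev-greedy error
`ϑ_m(x) = sup_π inf_{a_1, …, a_m} ‖x - ∑_{i ≤ m} a_i e_{π(i)}‖`. -/
def chebyshevGreedyError {𝕜 X : Type*} [RCLike 𝕜] [AddCommGroup X] [Module 𝕜 X]
    (N : X → ℝ) (e : ℕ → X) (es : ℕ → X →ₗ[𝕜] 𝕜) (m : ℕ) (x : X) : ℝ≥0∞ :=
  ⨆ (π : ℕ → ℕ) (_ : IsGreedyOrdering es x π),
    ⨅ a : ℕ → 𝕜, ENNReal.ofReal (N (x - ∑ i ∈ Finset.range m, a i • e (π i)))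

/-- The `m`-term error of approximation `σ_m(x)`. -/
def bestTermError (𝕜 : Type*) {X : Type*} [RCLike 𝕜] [AddCommGroup X] [Module 𝕜 X]
    (N : X → ℝ) (e : ℕ → X) (m : ℕ) (x : X) : ℝ≥0∞ :=
  ⨅ (A : Finset ℕ) (_ : A.card = m) (b : ℕ → 𝕜), ENNReal.ofReal (N (x - ∑ n ∈ A, b n • e n))

def IsQuasiGreedy {𝕜 X : Type*} [RCLike 𝕜] [AddCommGroup X] [Module 𝕜 X]
    (N : X → ℝ) (e : ℕ → X) (es : ℕ → X →ₗ[𝕜] 𝕜) : Prop :=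
  ∃ C : ℝ, 0 < C ∧ ∀ (m : ℕ) (x : X), 1 ≤ m →
    greedyError N e es m x ≤ ENNReal.ofReal C * ENNReal.ofReal (N x)

def IsSemiGreedy {𝕜 X : Type*} [RCLike 𝕜] [AddCommGroup X] [Module 𝕜 X]
    (N : X → ℝ) (e : ℕ → X) (es : ℕ → X →ₗ[𝕜] 𝕜) : Prop :=
  ∃ C : ℝ, 0 < C ∧ ∀ (m : ℕ) (x : X), 1 ≤ m →
    chebyshevGreedyError N e es m x ≤ ENNReal.ofReal C * bestTermError 𝕜 N e m x

/-- The indicator sum `1_{εA}`. -/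
def indicatorSum {𝕜 X : Type*} [RCLike 𝕜] [AddCommGroup X] [Module 𝕜 X]
    (e : ℕ → X) (ε : ℕ → 𝕜) (A : Finset ℕ) : X :=
  ∑ n ∈ A, ε n • e n

/-- The upper (right) democracy function
`h_r(m) = sup {‖1_{εA}‖ : |A| ≤ m, |ε| = 1}`. -/
def upperDemocracy (𝕜 : Type*) {X : Type*} [RCLike 𝕜] [AddCommGroup X] [Module 𝕜 X]
    (N : X → ℝ) (e : ℕ → X) (m : ℕ) : ℝ≥0∞ :=
  ⨆ (A : Finset ℕ) (_ : A.card ≤ m) (ε : ℕ → 𝕜) (_ : ∀ n ∈ A, ‖ε n‖ = 1),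
    ENNReal.ofReal (N (indicatorSum e ε A))

/-- Property (W). As `e` is numbered from `0`, "all indices in `A` exceed `m`" reads
`∀ k ∈ A, m < k + 1`. -/
def HasPropertyW (𝕜 : Type*) {X : Type*} [RCLike 𝕜] [AddCommGroup X] [Module 𝕜 X]
    (N : X → ℝ) (e : ℕ → X) : Prop :=
  ∃ C : ℝ, 0 < C ∧ ∀ n m : ℕ, 1 ≤ n → n ≤ m →
    ∃ (A : Finset ℕ) (ε : ℕ → 𝕜), (∀ k ∈ A, m < k + 1) ∧ A.card = n ∧ (∀ k ∈ A, ‖ε k‖ = 1) ∧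
      upperDemocracy 𝕜 N e n ≤ ENNReal.ofReal C * ENNReal.ofReal (N (indicatorSum e ε A))

/-- Doubling weights `ω(1), ω(2), …`: positive, nondecreasing, tending to infinity, and
`ω(2n) ≤ θ ω(n)`. The value `ω 0` plays no role here or below. -/
structure IsDoublingWeight (ω : ℕ → ℝ) : Prop where
  pos : 0 < ω 1
  mono : ∀ m n, 1 ≤ m → m ≤ n → ω m ≤ ω n
  tendsto : Filter.Tendsto ω Filter.atTop Filter.atTop
  doubling : ∃ θ : ℝ, 1 ≤ θ ∧ ∀ n, 1 ≤ n → ω (2 * n) ≤ θ * ω n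

/-- `φ_ω(M) = inf_{k ≥ 1} ω(M k) / ω(k)`. -/
def lowerDilation (ω : ℕ → ℝ) (M : ℕ) : ℝ :=
  ⨅ k : ℕ, ω (M * (k + 1)) / ω (k + 1)

/-- The lower dilation index `i_ω = sup_{M > 1} ln φ_ω(M) / ln M`. -/
def lowerDilationIndex (ω : ℕ → ℝ) : EReal :=
  ⨆ (M : ℕ) (_ : 1 < M), ((Real.log (lowerDilation ω M) / Real.log M : ℝ) : EReal)

/-- `‖x‖ + (∑_{n ≥ 1} (ω(n) E_n(x))^q / n)^{1/q}` for `q < ∞`, and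
`‖x‖ + sup_{n ≥ 1} ω(n) E_n(x)` for `q = ∞`, where `E_n` is a sequence of errors. -/
def errorQNorm {X : Type*} (N : X → ℝ) (ω : ℕ → ℝ) (q : ℝ≥0∞) (E : ℕ → X → ℝ≥0∞) (x : X) :
    ℝ≥0∞ :=
  ENNReal.ofReal (N x) +
    if q = ∞ then ⨆ n : ℕ, ENNReal.ofReal (ω (n + 1)) * E (n + 1) x
    else (∑' n : ℕ, (ENNReal.ofReal (ω (n + 1)) * E (n + 1) x) ^ q.toReal
      / ((n + 1 : ℕ) : ℝ≥0∞)) ^ (1 / q.toReal)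

/-- The quasi-norm of the approximation space `𝒜_q^ω`, with value `∞` outside the space. -/
def approxQNorm (𝕜 : Type*) {X : Type*} [RCLike 𝕜] [AddCommGroup X] [Module 𝕜 X]
    (N : X → ℝ) (e : ℕ → X) (ω : ℕ → ℝ) (q : ℝ≥0∞) : X → ℝ≥0∞ :=
  errorQNorm N ω q (bestTermError 𝕜 N e)

/-- The quantity `‖·‖` of the Chebyshev-greedy class `𝒞𝒢_q^ω`, with value `∞` outside it. -/
def chebyshevQNorm {𝕜 X : Type*} [RCLike 𝕜] [AddCommGroup X] [Module 𝕜 X]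
    (N : X → ℝ) (e : ℕ → X) (es : ℕ → X →ₗ[𝕜] 𝕜) (ω : ℕ → ℝ) (q : ℝ≥0∞) : X → ℝ≥0∞ :=
  errorQNorm N ω q (chebyshevGreedyError N e es)

/-- The class of the `x` at which a quantity is finite. -/
def finiteClass {X : Type*} (ν : X → ℝ≥0∞) : Set X := {x | ν x < ∞}

/-- `Y ↪ Z` for the classes `Y`, `Z` given by `ν`, `μ`: `Y ⊆ Z` and `‖x‖_Z ≤ C ‖x‖_Y` on `Y`. -/
def ContEmbeds {X : Type*} (ν μ : X → ℝ≥0∞) : Prop :=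
  finiteClass ν ⊆ finiteClass μ ∧
    ∃ C : ℝ, 0 < C ∧ ∀ x ∈ finiteClass ν, μ x ≤ ENNReal.ofReal C * ν x

/-- `Y ≈ Z`: embeddings in both directions. -/
def ClassesEquiv {X : Type*} (ν μ : X → ℝ≥0∞) : Prop :=
  ContEmbeds ν μ ∧ ContEmbeds μ ν

end

/-!
For an M-basis `σ_n ≤ ϑ_n`, and semi-greediness is the reverse estimate up to a constant, so the
first part holds term by term.

For the converse, given signs `ε` on `B` and `d ≤ |B|`, Property (W) yields a set `D` to the right
of `B` with `|D| = d` and `‖1_{δD}‖ ≳ h_r(d)`. On `x = 2 · 1_{εB} + 1_{δD}` the greedy algorithm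
must exhaust `B` before it touches `D`, so the Schauder property gives `ϑ_k(x) ≳ ‖1_{δD}‖` for all
`k ≤ |B|`, whereas `σ_k(x) ≤ 2 ‖1_{εB}‖` as soon as `k ≥ d`. Since `ω` is doubling with positive
dilation index, the `L^q` norm of `ω(1), …, ω(n)` for the measure `∑ δ_n / n` is of order `ω(n)`,
so the embedding says `h_r(d) ω(|B|) ≲ h_r(d) ω(d) + ‖1_{εB}‖ ω(|B|)`. For `d = |B| / M` with `M`
large, the first term on the right is absorbed and the basis is superdemocratic: `h_r(|B|) ≲
‖1_{εB}‖`. Finally, a quasi-greedy superdemocratic basis is semi-greedy: truncating the error of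
any approximation supported on `B` at the greedy threshold, and correcting the bounded
coefficients that remain, moves the approximation to the greedy set.
-/

section QuasiNorm

variable {𝕜 : Type*} [RCLike 𝕜] {X : Type*} [AddCommGroup X] [Module 𝕜 X] {N : X → ℝ} {κ : ℝ}

/-- `N` is a quasi-norm on the `𝕜`-vector space `X` with modulus of concavity at most `κ`. The
constant is a parameter, so that estimates can name it, and `X` need not be complete. -/
structure IsQuasiNorm (𝕜 : Type*) {X : Type*} [RCLike 𝕜] [AddCommGroup X] [Module 𝕜 X]
    (N : X → ℝ) (κ : ℝ) : Prop where
  one_le : 1 ≤ κ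
  nonneg : ∀ x, 0 ≤ N x
  eq_zero_iff : ∀ x, N x = 0 ↔ x = 0
  smul : ∀ (t : 𝕜) (x : X), N (t • x) = ‖t‖ * N x
  add_le : ∀ x y, N (x + y) ≤ κ * (N x + N y)

theorem IsQuasiBanach.exists_isQuasiNorm (hN : IsQuasiBanach 𝕜 N) : ∃ κ, IsQuasiNorm 𝕜 N κ :=
  let ⟨κ, one_le, add_le⟩ := hN.add_le
  ⟨κ, one_le, hN.nonneg, hN.eq_zero_iff, hN.smul, add_le⟩

namespace IsQuasiNorm

theorem pos (hN : IsQuasiNorm 𝕜 N κ) : 0 < κ := one_pos.trans_le hN.one_le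

theorem map_zero (hN : IsQuasiNorm 𝕜 N κ) : N 0 = 0 := (hN.eq_zero_iff 0).2 rfl

theorem map_neg (hN : IsQuasiNorm 𝕜 N κ) (x : X) : N (-x) = N x := by
  simpa using hN.smul (-1 : 𝕜) x

theorem sub_le (hN : IsQuasiNorm 𝕜 N κ) (x y : X) : N (x - y) ≤ κ * (N x + N y) := by
  simpa [sub_eq_add_neg, hN.map_neg] using hN.add_le x (-y)

theorem smul_of_nonneg (hN : IsQuasiNorm 𝕜 N κ) {t : ℝ} (ht : 0 ≤ t) (x : X) :
    N ((t : 𝕜) • x) = t * N x := by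
  rw [hN.smul, RCLike.norm_of_nonneg ht]

theorem sum_le (hN : IsQuasiNorm 𝕜 N κ) {ι : Type*} (s : Finset ι) (f : ι → X) :
    N (∑ i ∈ s, f i) ≤ κ ^ s.card * ∑ i ∈ s, N (f i) := by
  classical
  induction s using Finset.induction_on with
  | empty => simp [hN.map_zero]
  | insert a s ha ih =>
    rw [Finset.sum_insert ha, Finset.sum_insert ha, Finset.card_insert_of_notMem ha]
    calc N (f a + ∑ i ∈ s, f i)
      _ ≤ κ * (N (f a) + N (∑ i ∈ s, f i)) := hN.add_le _ _
      _ ≤ κ * (κ ^ s.card * N (f a) + κ ^ s.card * ∑ i ∈ s, N (f i)) := by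
        have := hN.pos
        gcongr
        exact le_mul_of_one_le_left (hN.nonneg _) (one_le_pow₀ hN.one_le)
      _ = κ ^ (s.card + 1) * (N (f a) + ∑ i ∈ s, N (f i)) := by ring

theorem average_le (hN : IsQuasiNorm 𝕜 N κ) {M : ℕ} (hM : 0 < M) {y : ℕ → X} {A : ℝ}
    (hA : ∀ k, N (y k) ≤ A) : N (∑ k ∈ Finset.range M, ((1 / M : ℝ) : 𝕜) • y k) ≤ κ ^ M * A := by
  have hκ := hN.pos
  calc N (∑ k ∈ Finset.range M, ((1 / M : ℝ) : 𝕜) • y k)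
    _ ≤ κ ^ M * ∑ k ∈ Finset.range M, N (((1 / M : ℝ) : 𝕜) • y k) := by
      simpa using hN.sum_le (Finset.range M) fun k => ((1 / M : ℝ) : 𝕜) • y k
    _ ≤ κ ^ M * ∑ _k ∈ Finset.range M, 1 / M * A := by
      gcongr
      rw [hN.smul_of_nonneg (by positivity)]
      gcongr
      exact hA _
    _ = κ ^ M * A := by
      rw [Finset.sum_const, Finset.card_range, nsmul_eq_mul]
      field_simp

end IsQuasiNorm

theorem sum_range_ite_le_eq_floor_nsmul {Y : Type*} [AddCommMonoid Y] {M : ℕ} (hM : 0 < M) {c : ℝ}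
    (h0 : 0 ≤ c) (h1 : c ≤ 1) (y : Y) :
    ∑ k ∈ Finset.range M, (if ((k + 1 : ℕ) : ℝ) / M ≤ c then y else 0) = ⌊c * M⌋₊ • y := by
  have hM' : (0 : ℝ) < M := mod_cast hM
  have hfilter : {k ∈ Finset.range M | ((k + 1 : ℕ) : ℝ) / M ≤ c} = Finset.range ⌊c * M⌋₊ := by
    have hfloor : ⌊c * M⌋₊ ≤ M := Nat.floor_le_of_le (mul_le_of_le_one_left hM'.le h1)
    ext k
    rw [Finset.mem_filter, Finset.mem_range, Finset.mem_range, div_le_iff₀ hM',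
      ← Nat.le_floor_iff (by positivity)]
    omega
  rw [← Finset.sum_filter, hfilter, Finset.sum_const, Finset.card_range]

/-- A quasi-norm has no convexity to exploit, so the multipliers `c` are rounded down to multiples
of `1 / M`: this costs `M` of the sums controlled by `A` and leaves multipliers of size `1 / M`,
small enough to be absorbed in the applications. -/
theorem IsQuasiNorm.exists_sum_smul_le (hN : IsQuasiNorm 𝕜 N κ) {ι : Type*} {D : Finset ι}
    {y : ι → X} {c : ι → ℝ} (hc : ∀ i ∈ D, 0 ≤ c i ∧ c i ≤ 1) {A : ℝ}
    (hA : ∀ t > 0, N (∑ i ∈ D with t ≤ c i, y i) ≤ A) {M : ℕ} (hM : 0 < M) :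
    ∃ r : ι → ℝ, (∀ i ∈ D, 0 ≤ r i ∧ r i ≤ 1 / M) ∧
      N (∑ i ∈ D, (c i : 𝕜) • y i) ≤ κ * (κ ^ M * A + N (∑ i ∈ D, (r i : 𝕜) • y i)) := by
  have hM' : (0 : ℝ) < M := mod_cast hM
  have hκ := hN.pos
  let Y : ℕ → X := fun k => ∑ i ∈ D with ((k + 1 : ℕ) : ℝ) / M ≤ c i, y i
  let r : ι → ℝ := fun i => c i - 1 / M * ⌊c i * M⌋₊
  have hr : ∀ i, c i = 1 / M * ⌊c i * M⌋₊ + r i := fun i => by ring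
  have hsplit : ∑ i ∈ D, (c i : 𝕜) • y i =
      ∑ k ∈ Finset.range M, ((1 / M : ℝ) : 𝕜) • Y k + ∑ i ∈ D, (r i : 𝕜) • y i := by
    simp only [Y, Finset.sum_filter]
    rw [← Finset.smul_sum, Finset.sum_comm, Finset.smul_sum, ← Finset.sum_add_distrib]
    refine Finset.sum_congr rfl fun i hi => ?_
    rw [sum_range_ite_le_eq_floor_nsmul hM (hc i hi).1 (hc i hi).2, ← Nat.cast_smul_eq_nsmul 𝕜,
      smul_smul, ← add_smul, hr i]
    simp [r]
  have hrounded : N (∑ k ∈ Finset.range M, ((1 / M : ℝ) : 𝕜) • Y k) ≤ κ ^ M * A :=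
    hN.average_le hM fun k => hA _ (by positivity)
  refine ⟨r, fun i hi => ⟨?_, ?_⟩, ?_⟩
  · have := Nat.floor_le (mul_nonneg (hc i hi).1 hM'.le)
    simp only [r]
    field_simp
    linarith
  · have := Nat.lt_floor_add_one (c i * M)
    simp only [r]
    field_simp
    linarith
  · rw [hsplit]
    exact (hN.add_le _ _).trans (by gcongr)

end QuasiNorm

section Basis

variable {𝕜 : Type*} [RCLike 𝕜] {X : Type*} [AddCommGroup X] [Module 𝕜 X] {N : X → ℝ} {κ : ℝ}
  {e : ℕ → X} {es : ℕ → X →ₗ[𝕜] 𝕜}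

theorem IsQuasiNorm.norm_apply_le_of_dualQNorm_le (hN : IsQuasiNorm 𝕜 N κ) {f : X →ₗ[𝕜] 𝕜}
    {c : ℝ} (hc : 0 ≤ c) (hf : dualQNorm N f ≤ ENNReal.ofReal c) (x : X) : ‖f x‖ ≤ c * N x := by
  rcases (hN.nonneg x).eq_or_lt with h0 | h0
  · rw [(hN.eq_zero_iff x).1 h0.symm]
    simp [hN.map_zero]
  · have hunit : N ((((N x)⁻¹ : ℝ) : 𝕜) • x) ≤ 1 := by
      rw [hN.smul_of_nonneg (by positivity), inv_mul_cancel₀ h0.ne']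
    have hfx : ENNReal.ofReal ‖f ((((N x)⁻¹ : ℝ) : 𝕜) • x)‖ ≤ ENNReal.ofReal c :=
      (le_iSup₂ (f := fun y (_ : N y ≤ 1) => ENNReal.ofReal ‖f y‖) _ hunit).trans hf
    rw [ENNReal.ofReal_le_ofReal_iff hc, map_smul, norm_smul, RCLike.norm_of_nonneg (by positivity),
      inv_mul_le_iff₀' h0] at hfx
    exact hfx

namespace IsMBasis

theorem exists_bound (hN : IsQuasiNorm 𝕜 N κ) (hB : IsMBasis N e es) :
    ∃ c : ℝ, 0 < c ∧ (∀ n, N (e n) ≤ c) ∧ ∀ n x, ‖es n x‖ ≤ c * N x := by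
  obtain ⟨c₁, c₂, hc₁, h⟩ := hB.seminormalized
  have hc : 0 < c₂ := hc₁.trans_le ((h 0).1.1.trans (h 0).1.2)
  exact ⟨c₂, hc, fun n => (h n).1.2, fun n => hN.norm_apply_le_of_dualQNorm_le hc.le (h n).2.2⟩

theorem coeff_sum (hB : IsMBasis N e es) (A : Finset ℕ) (a : ℕ → 𝕜) (n : ℕ) :
    es n (∑ k ∈ A, a k • e k) = if n ∈ A then a n else 0 := by
  simp [hB.biorthogonal]

theorem finite_setOf_coeff_ne_zero (hB : IsMBasis N e es) {y : X}
    (hy : y ∈ Submodule.span 𝕜 (Set.range e)) : {n | es n y ≠ 0}.Finite := by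
  obtain ⟨a, rfl⟩ := Finsupp.mem_span_range_iff_exists_finsupp.1 hy
  refine a.support.finite_toSet.subset fun n hn => Finset.mem_coe.2 ?_
  by_contra hna
  exact hn (by rw [Finsupp.sum, hB.coeff_sum, if_neg hna])

theorem finite_setOf_le_coeff (hN : IsQuasiNorm 𝕜 N κ) (hB : IsMBasis N e es) (x : X) {s : ℝ}
    (hs : 0 < s) : {n | s ≤ ‖es n x‖}.Finite := by
  obtain ⟨c, hc, -, hes⟩ := hB.exists_bound hN
  obtain ⟨y, hy, hxy⟩ := hB.dense_span x (s / c) (by positivity)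
  refine (hB.finite_setOf_coeff_ne_zero hy).subset fun n (hn : s ≤ ‖es n x‖) hny => ?_
  have hle : ‖es n x‖ ≤ c * N (x - y) := by simpa [hny] using hes n (x - y)
  exact ((lt_div_iff₀' hc).1 hxy).not_ge (hn.trans hle)

theorem exists_max_coeff (hN : IsQuasiNorm 𝕜 N κ) (hB : IsMBasis N e es) (x : X)
    (F : Finset ℕ) : ∃ n ∉ F, ∀ k ∉ F, ‖es k x‖ ≤ ‖es n x‖ := by
  by_cases h : ∃ n ∉ F, es n x ≠ 0
  · obtain ⟨n, hnF, hn⟩ := h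
    obtain ⟨k, ⟨hnk, hkF⟩, hmax⟩ := Set.exists_max_image
      {k | ‖es n x‖ ≤ ‖es k x‖ ∧ k ∉ F} (fun k => ‖es k x‖)
      ((hB.finite_setOf_le_coeff hN x (norm_pos_iff.2 hn)).subset fun _ => And.left)
      ⟨n, le_rfl, hnF⟩
    refine ⟨k, hkF, fun j hjF => ?_⟩
    rcases le_total ‖es n x‖ ‖es j x‖ with hj | hj
    · exact hmax j ⟨hj, hjF⟩
    · exact hj.trans hnk
  · push Not at h
    obtain ⟨n, hn⟩ := Infinite.exists_notMem_finset F
    exact ⟨n, hn, fun k hk => by simp [h k hk]⟩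

end IsMBasis

theorem exists_injective_seq_of_forall_finset {α : Type*} [DecidableEq α]
    {P : Finset α → α → Prop} (h : ∀ F, ∃ a ∉ F, P F a) :
    ∃ u : ℕ → α, Function.Injective u ∧ ∀ i, P ((Finset.range i).image u) (u i) := by
  choose g hg hP using h
  let F : ℕ → Finset α := fun i => Nat.rec ∅ (fun _ F => insert (g F) F) i
  have hF : ∀ i, F i = (Finset.range i).image fun j => g (F j) := by
    intro i
    induction i with
    | zero => rfl
    | succ i ih => rw [Finset.range_add_one, Finset.image_insert, ← ih]
  refine ⟨fun i => g (F i), .of_lt_imp_ne fun i j hij heq => hg (F j) ?_, fun i => ?_⟩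
  · rw [← heq, hF j]
    exact Finset.mem_image_of_mem _ (Finset.mem_range.2 hij)
  · exact hF i ▸ hP (F i)

theorem IsMBasis.exists_isGreedyOrdering (hN : IsQuasiNorm 𝕜 N κ) (hB : IsMBasis N e es) (x : X) :
    ∃ π, IsGreedyOrdering es x π := by
  obtain ⟨π, hinj, hmax⟩ := exists_injective_seq_of_forall_finset (hB.exists_max_coeff hN x)
  refine ⟨π, hinj, fun n hn => ?_, fun i j hij => hmax i (π j) ?_⟩
  · by_contra hnπ
    have hle : Set.range π ⊆ {k | ‖es n x‖ ≤ ‖es k x‖} := by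
      rintro _ ⟨i, rfl⟩
      refine hmax i n fun hni => hnπ ?_
      obtain ⟨j, -, rfl⟩ := Finset.mem_image.1 hni
      exact ⟨j, rfl⟩
    exact Set.infinite_range_of_injective hinj
      ((hB.finite_setOf_le_coeff hN x (norm_pos_iff.2 hn)).subset hle)
  · simpa [hinj.eq_iff] using hij

open Classical in
/-- The set of the indices `n` at which the coefficient of `x` has modulus at least `s`. For
`s > 0` this is a finite set; if it is not finite, the definition returns `∅`. -/
noncomputable def largeCoeffs (es : ℕ → X →ₗ[𝕜] 𝕜) (x : X) (s : ℝ) : Finset ℕ :=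
  if h : {n | s ≤ ‖es n x‖}.Finite then h.toFinset else ∅

theorem IsMBasis.mem_largeCoeffs (hN : IsQuasiNorm 𝕜 N κ) (hB : IsMBasis N e es) {x : X} {s : ℝ}
    (hs : 0 < s) {n : ℕ} : n ∈ largeCoeffs es x s ↔ s ≤ ‖es n x‖ := by
  simp [largeCoeffs, dif_pos (hB.finite_setOf_le_coeff hN x hs)]

/-- `G` is a strictly greedy set of `x`: the coefficients on `G` are strictly larger than those
off `G`, so that `G` is an initial segment of every greedy ordering of `x`. -/
def IsStrictlyGreedySet (es : ℕ → X →ₗ[𝕜] 𝕜) (x : X) (G : Finset ℕ) : Prop :=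
  ∀ i ∈ G, ∀ j ∉ G, ‖es j x‖ < ‖es i x‖

theorem IsMBasis.isStrictlyGreedySet_largeCoeffs (hN : IsQuasiNorm 𝕜 N κ) (hB : IsMBasis N e es)
    (x : X) {s : ℝ} (hs : 0 < s) : IsStrictlyGreedySet es x (largeCoeffs es x s) := by
  intro i hi j hj
  rw [hB.mem_largeCoeffs hN hs] at hi hj
  exact (not_le.1 hj).trans_le hi

namespace IsGreedyOrdering

theorem card_image_range {x : X} {π : ℕ → ℕ} (hπ : IsGreedyOrdering es x π) (m : ℕ) :
    ((Finset.range m).image π).card = m := by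
  rw [Finset.card_image_of_injective _ hπ.injective, Finset.card_range]

theorem sum_image_range {x : X} {π : ℕ → ℕ} (hπ : IsGreedyOrdering es x π) (m : ℕ) (f : ℕ → X) :
    ∑ n ∈ (Finset.range m).image π, f n = ∑ i ∈ Finset.range m, f (π i) :=
  Finset.sum_image hπ.injective.injOn

theorem coeff_le_of_notMem {x : X} {π : ℕ → ℕ} (hπ : IsGreedyOrdering es x π) {m j : ℕ}
    (hj : j ∉ (Finset.range m).image π) : ‖es j x‖ ≤ ‖es (π m) x‖ := by
  by_cases hjx : es j x = 0
  · simp [hjx]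
  · obtain ⟨l, rfl⟩ := hπ.support_subset hjx
    exact hπ.decreasing m l (by simpa [hπ.injective.eq_iff] using hj)

theorem le_coeff_of_mem {x : X} {π : ℕ → ℕ} (hπ : IsGreedyOrdering es x π) {m i : ℕ}
    (hi : i ∈ (Finset.range m).image π) : ‖es (π m) x‖ ≤ ‖es i x‖ := by
  obtain ⟨k, hk, rfl⟩ := Finset.mem_image.1 hi
  exact hπ.decreasing k m (Finset.mem_range.1 hk).le

theorem image_range_card {x : X} {π : ℕ → ℕ} (hπ : IsGreedyOrdering es x π) {G : Finset ℕ}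
    (hG : IsStrictlyGreedySet es x G) : (Finset.range G.card).image π = G := by
  set P := (Finset.range G.card).image π
  have hcard : P.card = G.card := hπ.card_image_range G.card
  by_contra hne
  obtain ⟨i, hiP, hiG⟩ := Finset.not_subset.1 fun h =>
    hne (Finset.eq_of_subset_of_card_le h hcard.ge)
  obtain ⟨j, hjG, hjP⟩ := Finset.not_subset.1 fun h =>
    hne (Finset.eq_of_subset_of_card_le h hcard.le).symm
  exact (hG j hjG i hiG).not_ge
    ((hπ.coeff_le_of_notMem hjP).trans (hπ.le_coeff_of_mem hiP))

end IsGreedyOrdering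

theorem bestTermError_le {A : Finset ℕ} (b : ℕ → 𝕜) (x : X) :
    bestTermError 𝕜 N e A.card x ≤ ENNReal.ofReal (N (x - ∑ n ∈ A, b n • e n)) :=
  iInf_le_of_le A (iInf_le_of_le rfl (iInf_le _ b))

theorem IsMBasis.bestTermError_le_chebyshevGreedyError (hN : IsQuasiNorm 𝕜 N κ)
    (hB : IsMBasis N e es) (m : ℕ) (x : X) :
    bestTermError 𝕜 N e m x ≤ chebyshevGreedyError N e es m x := by
  obtain ⟨π, hπ⟩ := hB.exists_isGreedyOrdering hN x
  refine le_iSup₂_of_le π hπ (le_iInf fun a => ?_)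
  simpa [hπ.card_image_range, hπ.sum_image_range, hπ.injective.extend_apply] using
    bestTermError_le (N := N) (e := e) (A := (Finset.range m).image π) (Function.extend π a 0) x

namespace IsQuasiGreedy

theorem exists_sub_sum_le (hN : IsQuasiNorm 𝕜 N κ) (hB : IsMBasis N e es)
    (hqg : IsQuasiGreedy N e es) :
    ∃ C : ℝ, 1 ≤ C ∧ ∀ (x : X) (G : Finset ℕ), IsStrictlyGreedySet es x G →
      N (x - ∑ n ∈ G, es n x • e n) ≤ C * N x := by
  obtain ⟨C, hC, h⟩ := hqg
  refine ⟨max C 1, le_max_right _ _, fun x G hG => ?_⟩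
  rcases G.eq_empty_or_nonempty with rfl | hne
  · simpa using le_mul_of_one_le_left (hN.nonneg x) (le_max_right C 1)
  · obtain ⟨π, hπ⟩ := hB.exists_isGreedyOrdering hN x
    have hsum : greedySum e es π G.card x = ∑ n ∈ G, es n x • e n := by
      rw [greedySum, ← hπ.sum_image_range _ fun n => es n x • e n, hπ.image_range_card hG]
    have herr : ENNReal.ofReal (N (x - ∑ n ∈ G, es n x • e n)) ≤ ENNReal.ofReal (C * N x) := by
      rw [ENNReal.ofReal_mul hC.le, ← hsum]
      exact (le_iSup₂ (f := fun π _ => ENNReal.ofReal (N (x - greedySum e es π G.card x)))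
        π hπ).trans (h G.card x hne.card_pos)
    have hN0 := hN.nonneg x
    rw [ENNReal.ofReal_le_ofReal_iff (by positivity)] at herr
    exact herr.trans (by gcongr; exact le_max_left C 1)

theorem exists_sum_sdiff_le (hN : IsQuasiNorm 𝕜 N κ) (hB : IsMBasis N e es)
    (hqg : IsQuasiGreedy N e es) :
    ∃ C : ℝ, 1 ≤ C ∧ ∀ (x : X) (G H : Finset ℕ), IsStrictlyGreedySet es x G →
      IsStrictlyGreedySet es x H → H ⊆ G → N (∑ n ∈ G \ H, es n x • e n) ≤ C * N x := by
  obtain ⟨C, hC, h⟩ := hqg.exists_sub_sum_le hN hB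
  refine ⟨κ * (C + C), ?_, fun x G H hG hH hHG => ?_⟩
  · nlinarith [hN.one_le]
  · have hκ := hN.pos
    calc N (∑ n ∈ G \ H, es n x • e n)
      _ = N ((x - ∑ n ∈ H, es n x • e n) - (x - ∑ n ∈ G, es n x • e n)) := by
        rw [sub_sub_sub_cancel_left, Finset.sum_sdiff_eq_sub hHG]
      _ ≤ κ * (C * N x + C * N x) := (hN.sub_le _ _).trans (by gcongr <;> exact h x _ ‹_›)
      _ = κ * (C + C) * N x := by ring

theorem exists_sum_filter_le (hN : IsQuasiNorm 𝕜 N κ) (hB : IsMBasis N e es)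
    (hqg : IsQuasiGreedy N e es) :
    ∃ C : ℝ, 1 ≤ C ∧ ∀ (x : X) (G : Finset ℕ) (p : ℕ → Prop) [DecidablePred p],
      IsStrictlyGreedySet es x G →
      (∀ i ∈ G, ∀ j ∈ G, ‖es i x‖ ≤ ‖es j x‖ → p j → p i) →
      N (∑ n ∈ G with p n, es n x • e n) ≤ C * N x := by
  obtain ⟨C, hC, h⟩ := hqg.exists_sum_sdiff_le hN hB
  refine ⟨C, hC, fun x G p _ hG hp => ?_⟩
  have hH : IsStrictlyGreedySet es x {n ∈ G | ¬ p n} := by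
    intro i hi j hj
    rw [Finset.mem_filter] at hi hj
    by_cases hjG : j ∈ G
    · exact lt_of_not_ge fun hij => hi.2 (hp i hi.1 j hjG hij (by tauto))
    · exact hG i hi.1 j hjG
  have hsdiff : G \ {n ∈ G | ¬ p n} = {n ∈ G | p n} := by
    ext n
    simp only [Finset.mem_sdiff, Finset.mem_filter]
    tauto
  rw [← hsdiff]
  exact h x G _ hG hH (Finset.filter_subset _ G)

end IsQuasiGreedy

end Basis

section Convexity

variable {𝕜 : Type*} [RCLike 𝕜] {X : Type*} [AddCommGroup X] [Module 𝕜 X] {N : X → ℝ} {κ : ℝ}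

theorem ofReal_norm_mul_normalize (z : 𝕜) : (‖z‖ : 𝕜) * NormedSpace.normalize z = z := by
  rw [← RCLike.real_smul_eq_coe_mul, NormedSpace.norm_smul_normalize]

theorem ofReal_div_norm_mul (s : ℝ) (z : 𝕜) :
    ((s / ‖z‖ : ℝ) : 𝕜) * z = s * NormedSpace.normalize z := by
  rw [NormedSpace.normalize, RCLike.real_smul_eq_coe_mul]
  push_cast
  ring

theorem norm_normalize_le_one (z : 𝕜) : ‖NormedSpace.normalize z‖ ≤ 1 := by
  rcases eq_or_ne z 0 with rfl | hz
  · simp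
  · exact (NormedSpace.norm_normalize hz).le

variable {ι : Type*} {D : Finset ι} {y : ι → X} {A : ℝ}

theorem IsQuasiNorm.sum_smul_le_of_norm_le (hN : IsQuasiNorm 𝕜 N κ) {S t : ℝ} (ht : 0 < t)
    (hS : ∀ a : ι → 𝕜, (∀ i ∈ D, ‖a i‖ ≤ 1) → N (∑ i ∈ D, a i • y i) ≤ S)
    {b : ι → 𝕜} (hb : ∀ i ∈ D, ‖b i‖ ≤ t) : N (∑ i ∈ D, b i • y i) ≤ t * S := by
  have ht' : (t : 𝕜) ≠ 0 := RCLike.ofReal_ne_zero.2 ht.ne'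
  have hscale : ∑ i ∈ D, b i • y i = (t : 𝕜) • ∑ i ∈ D, (b i / t) • y i := by
    simp only [Finset.smul_sum, smul_smul, mul_div_cancel₀ _ ht']
  rw [hscale, hN.smul_of_nonneg ht.le]
  gcongr
  refine hS _ fun i hi => ?_
  rw [norm_div, RCLike.norm_of_nonneg ht.le]
  exact div_le_one_of_le₀ (hb i hi) ht.le

/-- Rounding the moduli of the multipliers loses a remainder with multipliers of modulus at most
`1 / M`, where `κ / M ≤ 1 / 2`; so the supremum of the left-hand side absorbs it. -/
theorem IsQuasiNorm.sum_smul_le_of_norm_le_one (hN : IsQuasiNorm 𝕜 N κ)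
    (hA : ∀ B ⊆ D, ∀ ε : ι → 𝕜, (∀ i ∈ B, ‖ε i‖ = 1) → N (∑ i ∈ B, ε i • y i) ≤ A)
    {a : ι → 𝕜} (ha : ∀ i ∈ D, ‖a i‖ ≤ 1) :
    N (∑ i ∈ D, a i • y i) ≤ 2 * κ ^ (⌈2 * κ⌉₊ + 1) * A := by
  have hκ := hN.pos
  set M := ⌈2 * κ⌉₊
  have hM : 0 < M := Nat.ceil_pos.2 (by positivity)
  have hM' : 2 * κ ≤ M := Nat.le_ceil _
  let V : Set ℝ := {v | ∃ a : ι → 𝕜, (∀ i ∈ D, ‖a i‖ ≤ 1) ∧ N (∑ i ∈ D, a i • y i) = v}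
  have hV : BddAbove V := by
    refine ⟨κ ^ D.card * ∑ i ∈ D, N (y i), ?_⟩
    rintro _ ⟨a, ha, rfl⟩
    refine (hN.sum_le D _).trans ?_
    gcongr with i hi
    rw [hN.smul]
    exact mul_le_of_le_one_left (hN.nonneg _) (ha i hi)
  have hbound : ∀ v ∈ V, v ≤ κ ^ (M + 1) * A + 1 / 2 * sSup V := by
    rintro _ ⟨a, ha, rfl⟩
    obtain ⟨r, hr, hle⟩ := hN.exists_sum_smul_le (y := fun i => NormedSpace.normalize (a i) • y i)
      (c := fun i => ‖a i‖) (fun i hi => ⟨norm_nonneg _, ha i hi⟩)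
      (fun t ht => hA _ (Finset.filter_subset _ _) _ fun i hi => NormedSpace.norm_normalize
        (norm_pos_iff.1 (ht.trans_le (Finset.mem_filter.1 hi).2))) hM
    have hrem : N (∑ i ∈ D, ((r i : 𝕜) * NormedSpace.normalize (a i)) • y i) ≤ 1 / M * sSup V := by
      refine hN.sum_smul_le_of_norm_le (by positivity) (fun b hb => le_csSup hV ⟨b, hb, rfl⟩)
        (b := fun i => (r i : 𝕜) * NormedSpace.normalize (a i)) fun i hi => ?_
      rw [norm_mul, RCLike.norm_of_nonneg (hr i hi).1]
      exact (mul_le_of_le_one_right (hr i hi).1 (norm_normalize_le_one _)).trans (hr i hi).2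
    simp only [smul_smul, ofReal_norm_mul_normalize] at hle hrem
    have hκM : κ * (1 / M) ≤ 1 / 2 := by field_simp; linarith
    have hS : 0 ≤ sSup V := Real.sSup_nonneg (by rintro _ ⟨a, -, rfl⟩; exact hN.nonneg _)
    calc N (∑ i ∈ D, a i • y i)
      _ ≤ κ * (κ ^ M * A + 1 / M * sSup V) := hle.trans (by gcongr)
      _ = κ ^ (M + 1) * A + κ * (1 / M) * sSup V := by ring
      _ ≤ κ ^ (M + 1) * A + 1 / 2 * sSup V := by gcongr
  have hS : sSup V ≤ κ ^ (M + 1) * A + 1 / 2 * sSup V := csSup_le ⟨_, a, ha, rfl⟩ hbound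
  linarith [le_csSup hV ⟨a, ha, rfl⟩]

end Convexity

section Democracy

variable {𝕜 : Type*} [RCLike 𝕜] {X : Type*} [AddCommGroup X] [Module 𝕜 X] {N : X → ℝ} {κ : ℝ}
  {e : ℕ → X} {es : ℕ → X →ₗ[𝕜] 𝕜}

/-- The upper democracy function `h_r` with values in `ℝ`. For the bases considered here
`upperDemocracy` is finite, so nothing is lost. -/
noncomputable def realUpperDemocracy (𝕜 : Type*) {X : Type*} [RCLike 𝕜] [AddCommGroup X]
    [Module 𝕜 X] (N : X → ℝ) (e : ℕ → X) (m : ℕ) : ℝ :=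
  (upperDemocracy 𝕜 N e m).toReal

theorem realUpperDemocracy_nonneg (n : ℕ) : 0 ≤ realUpperDemocracy 𝕜 N e n :=
  ENNReal.toReal_nonneg

theorem upperDemocracy_le {n : ℕ} {c : ℝ}
    (h : ∀ (A : Finset ℕ) (ε : ℕ → 𝕜), A.card ≤ n → (∀ k ∈ A, ‖ε k‖ = 1) →
      N (indicatorSum e ε A) ≤ c) : upperDemocracy 𝕜 N e n ≤ ENNReal.ofReal c :=
  iSup₂_le fun A hA => iSup₂_le fun ε hε => ENNReal.ofReal_le_ofReal (h A ε hA hε)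

theorem realUpperDemocracy_le {n : ℕ} {c : ℝ} (hc : 0 ≤ c)
    (h : ∀ (A : Finset ℕ) (ε : ℕ → 𝕜), A.card ≤ n → (∀ k ∈ A, ‖ε k‖ = 1) →
      N (indicatorSum e ε A) ≤ c) : realUpperDemocracy 𝕜 N e n ≤ c :=
  ENNReal.toReal_le_of_le_ofReal hc (upperDemocracy_le h)

theorem realUpperDemocracy_zero (hN : IsQuasiNorm 𝕜 N κ) : realUpperDemocracy 𝕜 N e 0 = 0 := by
  refine le_antisymm (realUpperDemocracy_le le_rfl fun A ε hA _ => ?_) (realUpperDemocracy_nonneg 0)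
  rw [Finset.card_eq_zero.1 (Nat.le_zero.1 hA), indicatorSum, Finset.sum_empty, hN.map_zero]

namespace IsMBasis

theorem upperDemocracy_ne_top (hN : IsQuasiNorm 𝕜 N κ) (hB : IsMBasis N e es) (n : ℕ) :
    upperDemocracy 𝕜 N e n ≠ ∞ := by
  obtain ⟨c, hc, hec, -⟩ := hB.exists_bound hN
  refine ne_top_of_le_ne_top (ENNReal.ofReal_ne_top (r := κ ^ n * (n * c)))
    (upperDemocracy_le fun A ε hA hε => ?_)
  have hκ := hN.pos
  calc N (indicatorSum e ε A)
    _ ≤ κ ^ A.card * ∑ i ∈ A, N (ε i • e i) := hN.sum_le _ _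
    _ ≤ κ ^ A.card * ∑ _i ∈ A, c := by
      gcongr with i hi
      rw [hN.smul, hε i hi, one_mul]
      exact hec i
    _ ≤ κ ^ n * (n * c) := by
      rw [Finset.sum_const, nsmul_eq_mul]
      gcongr
      exact hN.one_le

theorem ofReal_realUpperDemocracy (hN : IsQuasiNorm 𝕜 N κ) (hB : IsMBasis N e es) (n : ℕ) :
    ENNReal.ofReal (realUpperDemocracy 𝕜 N e n) = upperDemocracy 𝕜 N e n :=
  ENNReal.ofReal_toReal (hB.upperDemocracy_ne_top hN n)

theorem indicatorSum_le (hN : IsQuasiNorm 𝕜 N κ) (hB : IsMBasis N e es) {n : ℕ}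
    {A : Finset ℕ} {ε : ℕ → 𝕜} (hA : A.card ≤ n) (hε : ∀ k ∈ A, ‖ε k‖ = 1) :
    N (indicatorSum e ε A) ≤ realUpperDemocracy 𝕜 N e n :=
  (ENNReal.ofReal_le_iff_le_toReal (hB.upperDemocracy_ne_top hN n)).1
    (le_iSup₂_of_le (f := fun (A : Finset ℕ) (_ : A.card ≤ n) =>
      ⨆ (ε : ℕ → 𝕜) (_ : ∀ k ∈ A, ‖ε k‖ = 1), ENNReal.ofReal (N (indicatorSum e ε A))) A hA
      (le_iSup₂_of_le ε hε le_rfl))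

theorem realUpperDemocracy_mono (hN : IsQuasiNorm 𝕜 N κ) (hB : IsMBasis N e es) :
    Monotone (realUpperDemocracy 𝕜 N e) := fun _ n hmn =>
  realUpperDemocracy_le (realUpperDemocracy_nonneg n) fun _ _ hA hε =>
    hB.indicatorSum_le hN (hA.trans hmn) hε

theorem realUpperDemocracy_add_le (hN : IsQuasiNorm 𝕜 N κ) (hB : IsMBasis N e es) (m n : ℕ) :
    realUpperDemocracy 𝕜 N e (m + n) ≤
      κ * (realUpperDemocracy 𝕜 N e m + realUpperDemocracy 𝕜 N e n) := by
  have hκ := hN.pos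
  have hm := realUpperDemocracy_nonneg (𝕜 := 𝕜) (N := N) (e := e) m
  have hn := realUpperDemocracy_nonneg (𝕜 := 𝕜) (N := N) (e := e) n
  refine realUpperDemocracy_le (by positivity) fun A ε hA hε => ?_
  obtain ⟨A₁, hA₁, hcard⟩ := Finset.exists_subset_card_eq (min_le_left A.card m)
  have hcard' : (A \ A₁).card ≤ n := by
    rw [Finset.card_sdiff_of_subset hA₁]
    omega
  rw [indicatorSum, ← Finset.sum_sdiff hA₁, add_comm]
  refine (hN.add_le _ _).trans ?_
  gcongr
  · exact hB.indicatorSum_le hN (hcard.trans_le (min_le_right _ _)) fun k hk => hε k (hA₁ hk)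
  · exact hB.indicatorSum_le hN hcard' fun k hk => hε k (Finset.sdiff_subset hk)

theorem realUpperDemocracy_mul_le (hN : IsQuasiNorm 𝕜 N κ) (hB : IsMBasis N e es) (k n : ℕ) :
    realUpperDemocracy 𝕜 N e (k * n) ≤ (2 * κ) ^ k * realUpperDemocracy 𝕜 N e n := by
  have hκ := hN.one_le
  have hn := realUpperDemocracy_nonneg (𝕜 := 𝕜) (N := N) (e := e) n
  induction k with
  | zero => simpa using hB.realUpperDemocracy_mono hN n.zero_le
  | succ k ih =>
    have hone : 1 ≤ (2 * κ) ^ k := one_le_pow₀ (by linarith)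
    calc realUpperDemocracy 𝕜 N e ((k + 1) * n)
      _ ≤ κ * (realUpperDemocracy 𝕜 N e (k * n) + realUpperDemocracy 𝕜 N e n) := by
        rw [Nat.succ_mul]
        exact hB.realUpperDemocracy_add_le hN _ _
      _ ≤ κ * ((2 * κ) ^ k * realUpperDemocracy 𝕜 N e n +
            (2 * κ) ^ k * realUpperDemocracy 𝕜 N e n) := by
        gcongr
        exact le_mul_of_one_le_left hn hone
      _ = (2 * κ) ^ (k + 1) * realUpperDemocracy 𝕜 N e n := by ring

theorem exists_sum_smul_le_realUpperDemocracy (hN : IsQuasiNorm 𝕜 N κ) (hB : IsMBasis N e es) :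
    ∃ K : ℝ, 0 < K ∧ ∀ (B : Finset ℕ) (a : ℕ → 𝕜) (t : ℝ), 0 < t → (∀ n ∈ B, ‖a n‖ ≤ t) →
      N (∑ n ∈ B, a n • e n) ≤ K * (t * realUpperDemocracy 𝕜 N e B.card) := by
  have hκ := hN.pos
  refine ⟨2 * κ ^ (⌈2 * κ⌉₊ + 1), by positivity, fun B a t ht ha => ?_⟩
  rw [mul_left_comm]
  exact hN.sum_smul_le_of_norm_le ht (fun b hb => hN.sum_smul_le_of_norm_le_one
    (fun A hA ε hε => hB.indicatorSum_le hN (Finset.card_le_card hA) hε) hb) ha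

end IsMBasis

end Democracy

section SemiGreedy

variable {𝕜 : Type*} [RCLike 𝕜] {X : Type*} [AddCommGroup X] [Module 𝕜 X] {N : X → ℝ} {κ : ℝ}
  {e : ℕ → X} {es : ℕ → X →ₗ[𝕜] 𝕜}

/-- The basis is superdemocratic: the quasi-norms of any two indicator sums `1_{εA}`, `1_{δB}` with
`|A| ≤ |B|` satisfy `‖1_{εA}‖ ≤ C ‖1_{δB}‖`. The supremum over `A`, `ε` is `h_r(|B|)`. -/
def IsSuperDemocratic (𝕜 : Type*) {X : Type*} [RCLike 𝕜] [AddCommGroup X] [Module 𝕜 X]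
    (N : X → ℝ) (e : ℕ → X) : Prop :=
  ∃ C : ℝ, 0 < C ∧ ∀ (B : Finset ℕ) (ε : ℕ → 𝕜), (∀ k ∈ B, ‖ε k‖ = 1) →
    realUpperDemocracy 𝕜 N e B.card ≤ C * N (indicatorSum e ε B)

theorem IsQuasiGreedy.exists_sum_div_norm_smul_le (hN : IsQuasiNorm 𝕜 N κ)
    (hB : IsMBasis N e es) (hqg : IsQuasiGreedy N e es) :
    ∃ C K : ℝ, 0 < C ∧ 0 < K ∧ ∀ (x : X) {s b : ℝ}, 0 < s → 0 < b → ∀ {M : ℕ}, 0 < M →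
      ∀ D : Finset ℕ, D = {n ∈ largeCoeffs es x s | ‖es n x‖ < b * s} →
      N (∑ n ∈ D, ((s / ‖es n x‖ : ℝ) : 𝕜) • es n x • e n) ≤
        κ * (κ ^ M * (C * N x) + K * (b * s / M * realUpperDemocracy 𝕜 N e D.card)) := by
  obtain ⟨C, hC, hproj⟩ := hqg.exists_sum_filter_le hN hB
  obtain ⟨K, hK, hsum⟩ := hB.exists_sum_smul_le_realUpperDemocracy hN
  refine ⟨C, K, by positivity, hK, fun x s b hs hb M hM D hD => ?_⟩
  have hcoeff : ∀ n ∈ D, s ≤ ‖es n x‖ ∧ ‖es n x‖ < b * s := fun n hn =>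
    (Finset.mem_filter.1 (hD ▸ hn)).imp_left (hB.mem_largeCoeffs hN hs).1
  have hselect : ∀ t > 0, N (∑ n ∈ D with t ≤ s / ‖es n x‖, es n x • e n) ≤ C * N x := by
    intro t _
    rw [hD, Finset.filter_filter]
    refine hproj x _ _ (hB.isStrictlyGreedySet_largeCoeffs hN x hs) fun i hi j _ hij hj =>
      ⟨hij.trans_lt hj.1, hj.2.trans ?_⟩
    have hi0 : 0 < ‖es i x‖ := hs.trans_le ((hB.mem_largeCoeffs hN hs).1 hi)
    gcongr
  obtain ⟨r, hr, hround⟩ := hN.exists_sum_smul_le (c := fun n => s / ‖es n x‖)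
    (fun n hn => ⟨by positivity, div_le_one_of_le₀ (hcoeff n hn).1 (norm_nonneg _)⟩) hselect hM
  have hrem : N (∑ n ∈ D, (r n : 𝕜) • es n x • e n) ≤
      K * (b * s / M * realUpperDemocracy 𝕜 N e D.card) := by
    simp only [smul_smul]
    refine hsum D _ _ (by positivity) fun n hn => ?_
    rw [norm_mul, RCLike.norm_of_nonneg (hr n hn).1, ← one_div_mul_eq_div]
    exact mul_le_mul (hr n hn).2 (hcoeff n hn).2.le (norm_nonneg _) (by positivity)
  have hκ := hN.pos
  exact hround.trans (by gcongr)

namespace IsSuperDemocratic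

/-- The rounding error is absorbed in the left-hand side. -/
theorem exists_band_bound (hN : IsQuasiNorm 𝕜 N κ) (hB : IsMBasis N e es)
    (hqg : IsQuasiGreedy N e es) (hsd : IsSuperDemocratic 𝕜 N e) {b : ℝ} (hb : 0 < b) :
    ∃ C : ℝ, 0 < C ∧ ∀ (x : X) (s : ℝ), 0 < s →
      s * realUpperDemocracy 𝕜 N e {n ∈ largeCoeffs es x s | ‖es n x‖ < b * s}.card ≤ C * N x := by
  obtain ⟨Cd, hCd, hdem⟩ := hsd
  obtain ⟨Cq, K, hCq, hK, hround⟩ := hqg.exists_sum_div_norm_smul_le hN hB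
  have hκ := hN.pos
  set M := ⌈2 * (Cd * κ * K * b)⌉₊
  have hM : 0 < M := Nat.ceil_pos.2 (by positivity)
  have hM' : 2 * (Cd * κ * K * b) ≤ M := Nat.le_ceil _
  refine ⟨2 * (Cd * κ * κ ^ M * Cq), by positivity, fun x s hs => ?_⟩
  set D := {n ∈ largeCoeffs es x s | ‖es n x‖ < b * s} with hD
  set h := realUpperDemocracy 𝕜 N e D.card
  have hh : 0 ≤ h := realUpperDemocracy_nonneg _
  have hlower : s * h ≤ Cd * N (∑ n ∈ D, ((s / ‖es n x‖ : ℝ) : 𝕜) • es n x • e n) := by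
    simp only [smul_smul, ofReal_div_norm_mul]
    simp only [← smul_smul, ← Finset.smul_sum]
    rw [hN.smul_of_nonneg hs.le, mul_left_comm]
    gcongr
    exact hdem D _ fun n hn => NormedSpace.norm_normalize (norm_pos_iff.1
      (hs.trans_le ((hB.mem_largeCoeffs hN hs).1 (Finset.mem_filter.1 hn).1)))
  have habsorb : Cd * κ * (K * (b * s / M * h)) ≤ s * h / 2 := by
    field_simp
    nlinarith [mul_le_mul_of_nonneg_right hM' (mul_nonneg hs.le hh)]
  have hupper : s * h ≤ Cd * (κ * (κ ^ M * (Cq * N x) + K * (b * s / M * h))) :=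
    hlower.trans (by gcongr; exact hround x hs hb hM D hD)
  linarith

/-- The levels `s, b s, b² s, …` with `b = 2 κ` are summed by downward induction: each step costs a
factor `κ`, which the growth of the level compensates. -/
theorem exists_largeCoeffs_bound (hN : IsQuasiNorm 𝕜 N κ) (hB : IsMBasis N e es)
    (hqg : IsQuasiGreedy N e es) (hsd : IsSuperDemocratic 𝕜 N e) :
    ∃ C : ℝ, 0 < C ∧ ∀ (x : X) (s : ℝ), 0 < s →
      s * realUpperDemocracy 𝕜 N e (largeCoeffs es x s).card ≤ C * N x := by
  have hκ := hN.one_le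
  have hκ0 := hN.pos
  obtain ⟨C, hC, hband⟩ := hsd.exists_band_bound hN hB hqg (b := 2 * κ) (by positivity)
  obtain ⟨c, -, -, hes⟩ := hB.exists_bound hN
  refine ⟨2 * κ * C, by positivity, fun x s hs => ?_⟩
  obtain ⟨j, hj⟩ := pow_unbounded_of_one_lt (c * N x / s) (by linarith : 1 < 2 * κ)
  have hj' : ∀ n, ‖es n x‖ < (2 * κ) ^ j * s := fun n => (hes n x).trans_lt ((div_lt_iff₀ hs).1 hj)
  clear hj
  induction j generalizing s with
  | zero =>
    have hempty : largeCoeffs es x s = ∅ := Finset.eq_empty_of_forall_notMem fun n hn =>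
      ((hB.mem_largeCoeffs hN hs).1 hn).not_gt (by simpa using hj' n)
    have := hN.nonneg x
    rw [hempty, Finset.card_empty, realUpperDemocracy_zero hN, mul_zero]
    positivity
  | succ j ih =>
    have hnext := ih (2 * κ * s) (by positivity) fun n => by
      rw [← mul_assoc, ← pow_succ]
      exact hj' n
    have hfilter : {n ∈ largeCoeffs es x s | ¬ ‖es n x‖ < 2 * κ * s} =
        largeCoeffs es x (2 * κ * s) := by
      ext n
      rw [Finset.mem_filter, hB.mem_largeCoeffs hN hs, hB.mem_largeCoeffs hN (by positivity),
        not_lt]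
      exact ⟨And.right, fun h => ⟨by nlinarith, h⟩⟩
    rw [← Finset.card_filter_add_card_filter_not (s := largeCoeffs es x s)
      (fun n => ‖es n x‖ < 2 * κ * s), hfilter]
    set D := {n ∈ largeCoeffs es x s | ‖es n x‖ < 2 * κ * s}
    set h := realUpperDemocracy 𝕜 N e
    calc s * h (D.card + (largeCoeffs es x (2 * κ * s)).card)
      _ ≤ s * (κ * (h D.card + h (largeCoeffs es x (2 * κ * s)).card)) := by
        gcongr
        exact hB.realUpperDemocracy_add_le hN _ _
      _ = κ * (s * h D.card) + 2 * κ * s * h (largeCoeffs es x (2 * κ * s)).card / 2 := by ring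
      _ ≤ κ * (C * N x) + 2 * κ * C * N x / 2 := by
        have := mul_le_mul_of_nonneg_left (hband x s hs) hκ0.le
        linarith
      _ = 2 * κ * C * N x := by ring

theorem exists_truncation (hN : IsQuasiNorm 𝕜 N κ) (hB : IsMBasis N e es)
    (hqg : IsQuasiGreedy N e es) (hsd : IsSuperDemocratic 𝕜 N e) :
    ∃ C : ℝ, 0 < C ∧ ∀ (z : X) (α : ℝ), 0 < α → ∃ T : X, N T ≤ C * N z ∧
      (∀ n, ‖es n T‖ ≤ α) ∧ ∀ n, ‖es n z‖ ≤ α → es n T = es n z := by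
  obtain ⟨K, hK, hsum⟩ := hB.exists_sum_smul_le_realUpperDemocracy hN
  obtain ⟨Cq, hCq, hproj⟩ := hqg.exists_sub_sum_le hN hB
  obtain ⟨C, hC, hlarge⟩ := hsd.exists_largeCoeffs_bound hN hB hqg
  have hκ := hN.pos
  refine ⟨κ * (Cq + K * C), by positivity, fun z α hα => ?_⟩
  set G := largeCoeffs es z α
  let a : ℕ → 𝕜 := fun n => α * NormedSpace.normalize (es n z)
  have ha : ∀ n, ‖a n‖ ≤ α := fun n => by
    rw [norm_mul, RCLike.norm_of_nonneg hα.le]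
    exact mul_le_of_le_one_right hα.le (norm_normalize_le_one _)
  have hcoeff : ∀ n, es n (z - ∑ n ∈ G, es n z • e n + ∑ n ∈ G, a n • e n) =
      if n ∈ G then a n else es n z := fun n => by
    rw [map_add, map_sub, hB.coeff_sum, hB.coeff_sum]
    split_ifs <;> ring
  refine ⟨z - ∑ n ∈ G, es n z • e n + ∑ n ∈ G, a n • e n, ?_, fun n => ?_, fun n hn => ?_⟩
  · calc N (z - ∑ n ∈ G, es n z • e n + ∑ n ∈ G, a n • e n)
      _ ≤ κ * (Cq * N z + K * (C * N z)) := (hN.add_le _ _).trans (by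
        gcongr
        · exact hproj z G (hB.isStrictlyGreedySet_largeCoeffs hN z hα)
        · exact (hsum G a α hα fun n _ => ha n).trans
            (mul_le_mul_of_nonneg_left (hlarge z α hα) hK.le))
      _ = κ * (Cq + K * C) * N z := by ring
  · rw [hcoeff]
    split_ifs with hnG
    · exact ha n
    · exact (not_le.1 (mt (hB.mem_largeCoeffs hN hα).2 hnG)).le
  · rw [hcoeff, ite_eq_right_iff]
    intro hnG
    have hnα : ‖es n z‖ = α := hn.antisymm ((hB.mem_largeCoeffs hN hα).1 hnG)
    simp only [a, ← hnα, ofReal_norm_mul_normalize]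

/-- Truncating `z = x - ∑_B b_n e_n` at the level `α` leaves coefficients of modulus at most `2 α`
to be corrected, and only on `B \ A`. -/
theorem exists_coeff_eq_off (hN : IsQuasiNorm 𝕜 N κ) (hB : IsMBasis N e es)
    (hqg : IsQuasiGreedy N e es) (hsd : IsSuperDemocratic 𝕜 N e) :
    ∃ C : ℝ, 0 < C ∧ ∀ (x z : X) (A B : Finset ℕ) (α : ℝ), A.card = B.card → 0 < α →
      (∀ n ∈ A, α ≤ ‖es n x‖) → (∀ n ∉ A, ‖es n x‖ ≤ α) → (∀ n ∉ B, es n z = es n x) →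
      ∃ w : X, N w ≤ C * N z ∧ ∀ n ∉ A, es n w = es n x := by
  obtain ⟨K, hK, hsum⟩ := hB.exists_sum_smul_le_realUpperDemocracy hN
  obtain ⟨C₁, hC₁, hlarge⟩ := hsd.exists_largeCoeffs_bound hN hB hqg
  obtain ⟨C₂, hC₂, htrunc⟩ := hsd.exists_truncation hN hB hqg
  have hκ := hN.pos
  refine ⟨κ * (C₂ + 2 * K * C₁), by positivity, fun x z A B α hAB hα hA hA' hz => ?_⟩
  obtain ⟨T, hTN, hTα, hTz⟩ := htrunc z α hα
  have hcard : (B \ A).card ≤ (largeCoeffs es z α).card := by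
    rw [Finset.card_sdiff_comm hAB.symm]
    refine Finset.card_le_card fun n hn => ?_
    rw [Finset.mem_sdiff] at hn
    rw [hB.mem_largeCoeffs hN hα, hz n hn.2]
    exact hA n hn.1
  have hcorr : N (∑ n ∈ B \ A, es n (x - T) • e n) ≤ 2 * K * C₁ * N z := by
    calc N (∑ n ∈ B \ A, es n (x - T) • e n)
      _ ≤ K * (2 * α * realUpperDemocracy 𝕜 N e (B \ A).card) := by
        refine hsum _ _ _ (by positivity) fun n hn => ?_
        rw [map_sub, two_mul]
        exact norm_sub_le_of_le (hA' n (Finset.mem_sdiff.1 hn).2) (hTα n)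
      _ ≤ K * (2 * α * realUpperDemocracy 𝕜 N e (largeCoeffs es z α).card) := by
        gcongr
        exact hB.realUpperDemocracy_mono hN hcard
      _ = 2 * K * (α * realUpperDemocracy 𝕜 N e (largeCoeffs es z α).card) := by ring
      _ ≤ 2 * K * (C₁ * N z) := mul_le_mul_of_nonneg_left (hlarge z α hα) (by positivity)
      _ = 2 * K * C₁ * N z := by ring
  refine ⟨T + ∑ n ∈ B \ A, es n (x - T) • e n, ?_, fun n hnA => ?_⟩
  · calc N (T + ∑ n ∈ B \ A, es n (x - T) • e n)
      _ ≤ κ * (C₂ * N z + 2 * K * C₁ * N z) := (hN.add_le _ _).trans (by gcongr)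
      _ = κ * (C₂ + 2 * K * C₁) * N z := by ring
  · rw [map_add, hB.coeff_sum]
    by_cases hnB : n ∈ B
    · rw [if_pos (Finset.mem_sdiff.2 ⟨hnB, hnA⟩), map_sub, add_sub_cancel]
    · have hnT : es n T = es n z := hTz n ((hz n hnB).symm ▸ hA' n hnA)
      rw [if_neg fun h => hnB (Finset.mem_sdiff.1 h).1, add_zero, hnT, hz n hnB]

end IsSuperDemocratic

theorem IsMBasis.sub_sum_coeff_eq (hB : IsMBasis N e es) {x w : X} {A : Finset ℕ}
    (hw : ∀ n ∉ A, es n w = es n x) : x - ∑ n ∈ A, es n (x - w) • e n = w := by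
  refine sub_eq_zero.1 (hB.total _ fun n => ?_)
  rw [map_sub, map_sub, hB.coeff_sum]
  split_ifs with hn
  · rw [map_sub, sub_sub_cancel, sub_self]
  · rw [hw n hn, sub_zero, sub_self]

theorem IsSuperDemocratic.exists_chebyshev_le (hN : IsQuasiNorm 𝕜 N κ) (hB : IsMBasis N e es)
    (hqg : IsQuasiGreedy N e es) (hsd : IsSuperDemocratic 𝕜 N e) :
    ∃ C : ℝ, 0 < C ∧ ∀ (x : X) (π : ℕ → ℕ), IsGreedyOrdering es x π →
      ∀ (B : Finset ℕ) (b : ℕ → 𝕜), ∃ a : ℕ → 𝕜,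
        N (x - ∑ i ∈ Finset.range B.card, a i • e (π i)) ≤ C * N (x - ∑ n ∈ B, b n • e n) := by
  obtain ⟨C, hC, hoff⟩ := hsd.exists_coeff_eq_off hN hB hqg
  refine ⟨C, hC, fun x π hπ B b => ?_⟩
  set z := x - ∑ n ∈ B, b n • e n
  set A := (Finset.range B.card).image π
  suffices ∃ w, N w ≤ C * N z ∧ ∀ n ∉ A, es n w = es n x by
    obtain ⟨w, hwN, hw⟩ := this
    refine ⟨fun i => es (π i) (x - w), ?_⟩
    rwa [← hπ.sum_image_range _ fun n => es n (x - w) • e n, hB.sub_sum_coeff_eq hw]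
  have hA' : ∀ n ∉ A, ‖es n x‖ ≤ ‖es (π B.card) x‖ := fun n hn => hπ.coeff_le_of_notMem hn
  rcases (norm_nonneg (es (π B.card) x)).eq_or_lt with hα | hα
  · refine ⟨0, ?_, fun n hn => ?_⟩
    · rw [hN.map_zero]
      exact mul_nonneg hC.le (hN.nonneg _)
    · rw [map_zero, eq_comm, ← norm_le_zero_iff, hα]
      exact hA' n hn
  · refine hoff x z A B _ (hπ.card_image_range _) hα (fun n hn => hπ.le_coeff_of_mem hn) hA'
      fun n hn => ?_
    rw [map_sub, hB.coeff_sum, if_neg hn, sub_zero]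

theorem IsSuperDemocratic.isSemiGreedy (hN : IsQuasiNorm 𝕜 N κ) (hB : IsMBasis N e es)
    (hqg : IsQuasiGreedy N e es) (hsd : IsSuperDemocratic 𝕜 N e) : IsSemiGreedy N e es := by
  obtain ⟨C, hC, h⟩ := hsd.exists_chebyshev_le hN hB hqg
  refine ⟨C, hC, fun m x _ => iSup₂_le fun π hπ => ?_⟩
  simp only [bestTermError, ENNReal.mul_iInf_of_ne (by simpa using hC) ENNReal.ofReal_ne_top]
  refine le_iInf₂ fun B hBm => le_iInf fun b => ?_
  subst hBm
  obtain ⟨a, ha⟩ := h x π hπ B b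
  rw [← ENNReal.ofReal_mul hC.le]
  exact iInf_le_of_le a (ENNReal.ofReal_le_ofReal ha)

end SemiGreedy

section Weights

open MeasureTheory

namespace IsDoublingWeight

variable {ω : ℕ → ℝ}

theorem pos_of_one_le (hω : IsDoublingWeight ω) {n : ℕ} (hn : 1 ≤ n) : 0 < ω n :=
  hω.pos.trans_le (hω.mono 1 n le_rfl hn)

theorem exists_dilation (hω : IsDoublingWeight ω) (hi : 0 < lowerDilationIndex ω) :
    ∃ (M : ℕ) (φ : ℝ), 1 < M ∧ 1 < φ ∧ ∀ k, 1 ≤ k → φ * ω k ≤ ω (M * k) := by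
  obtain ⟨M, hM⟩ := lt_iSup_iff.1 hi
  obtain ⟨hM1, hM⟩ := lt_iSup_iff.1 hM
  have hratio : ∀ k : ℕ, 0 ≤ ω (M * (k + 1)) / ω (k + 1) := fun k =>
    div_nonneg (hω.pos_of_one_le (Nat.mul_pos (by omega) k.succ_pos)).le
      (hω.pos_of_one_le k.succ_pos).le
  have hlogM : 0 < Real.log M := Real.log_pos (mod_cast hM1)
  have hlog : 0 < Real.log (lowerDilation ω M) :=
    (div_pos_iff_of_pos_right hlogM).1 (mod_cast hM)
  refine ⟨M, lowerDilation ω M, hM1, ?_, fun k hk => ?_⟩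
  · exact (Real.log_pos_iff (le_ciInf hratio)).1 hlog
  · obtain ⟨k, rfl⟩ := Nat.exists_eq_add_of_le' hk
    rw [← le_div_iff₀ (hω.pos_of_one_le k.succ_pos)]
    exact ciInf_le ⟨0, by rintro _ ⟨j, rfl⟩; exact hratio j⟩ k

theorem exists_dilation_ge (hω : IsDoublingWeight ω) (hi : 0 < lowerDilationIndex ω) (c : ℝ) :
    ∃ M : ℕ, 1 < M ∧ ∀ k, 1 ≤ k → c * ω k ≤ ω (M * k) := by
  obtain ⟨M, φ, hM, hφ, h⟩ := hω.exists_dilation hi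
  obtain ⟨j, hj⟩ := pow_unbounded_of_one_lt c hφ
  have hiter : ∀ j k, 1 ≤ k → φ ^ j * ω k ≤ ω (M ^ j * k) := by
    intro j
    induction j with
    | zero => simp
    | succ j ih =>
      intro k hk
      rw [pow_succ', pow_succ', mul_assoc, mul_assoc]
      exact (mul_le_mul_of_nonneg_left (ih k hk) (by positivity)).trans
        (h _ (Nat.mul_pos (pow_pos (by omega) j) hk))
  refine ⟨M ^ (j + 1), Nat.one_lt_pow j.succ_ne_zero hM, fun k hk => ?_⟩
  have hc : c ≤ φ ^ (j + 1) := hj.le.trans (pow_le_pow_right₀ hφ.le j.le_succ)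
  exact (mul_le_mul_of_nonneg_right hc (hω.pos_of_one_le hk).le).trans (hiter (j + 1) k hk)

end IsDoublingWeight

/-- The measure on `ℕ` of mass `1 / (n + 1)` at `n`, that is `∑_{n ≥ 1} δ_n / n` with the indices
shifted by one. The quasi-norms `errorQNorm` are `L^q` norms for this measure. -/
noncomputable def harmonicMeasure : Measure ℕ :=
  Measure.count.withDensity fun n => ((n + 1 : ℕ) : ℝ≥0∞)⁻¹

theorem lintegral_harmonicMeasure (f : ℕ → ℝ≥0∞) :
    ∫⁻ n, f n ∂harmonicMeasure = ∑' n, f n / ((n + 1 : ℕ) : ℝ≥0∞) := by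
  rw [harmonicMeasure, lintegral_withDensity_eq_lintegral_mul _ (by fun_prop) (by fun_prop),
    lintegral_count]
  simp only [Pi.mul_apply, ENNReal.div_eq_inv_mul]

theorem harmonicMeasure_coe (s : Finset ℕ) :
    harmonicMeasure s = ∑ n ∈ s, ((n + 1 : ℕ) : ℝ≥0∞)⁻¹ := by
  rw [← lintegral_indicator_one s.measurableSet, lintegral_harmonicMeasure,
    tsum_eq_sum (s := s) fun n hn => by simp [hn]]
  exact Finset.sum_congr rfl fun n hn => by simp [hn]

theorem harmonicMeasure_Ico_div_le {M : ℕ} (hM : 0 < M) (n : ℕ) :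
    harmonicMeasure (Set.Ico (n / M) n) ≤ M := by
  rcases n.eq_zero_or_pos with rfl | hn
  · simp
  rw [← Finset.coe_Ico, harmonicMeasure_coe]
  have hterm : ∀ k ∈ Finset.Ico (n / M) n, ((k + 1 : ℕ) : ℝ≥0∞)⁻¹ ≤ M / n := fun k hk => by
    have hnk : (n : ℝ≥0∞) ≤ M * (k + 1 : ℕ) := by
      have hlt : n < M * (n / M + 1) := Nat.lt_mul_div_succ n hM
      exact_mod_cast hlt.le.trans (Nat.mul_le_mul_left M (by grind))
    rw [ENNReal.le_div_iff_mul_le (by simp [hn.ne']) (by simp), ← ENNReal.div_eq_inv_mul]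
    exact ENNReal.div_le_of_le_mul hnk
  calc ∑ k ∈ Finset.Ico (n / M) n, ((k + 1 : ℕ) : ℝ≥0∞)⁻¹
    _ ≤ (n - n / M : ℕ) * (M / n : ℝ≥0∞) := by
      simpa using Finset.sum_le_card_nsmul _ _ _ hterm
    _ ≤ n * (M / n : ℝ≥0∞) := by
      gcongr
      exact Nat.sub_le _ _
    _ = M := ENNReal.mul_div_cancel (by simpa using hn.ne') (by simp)

theorem le_harmonicMeasure_Ico_half {n : ℕ} (hn : 0 < n) :
    2⁻¹ ≤ harmonicMeasure (Set.Ico (n / 2) n) := by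
  rw [← Finset.coe_Ico, harmonicMeasure_coe]
  calc (2⁻¹ : ℝ≥0∞)
    _ ≤ (n - n / 2 : ℕ) * (n : ℝ≥0∞)⁻¹ := by
      rw [← div_eq_mul_inv, ENNReal.le_div_iff_mul_le (by simp [hn.ne']) (by simp),
        ← ENNReal.div_eq_inv_mul]
      refine ENNReal.div_le_of_le_mul ?_
      exact_mod_cast (by omega : n ≤ (n - n / 2) * 2)
    _ ≤ ∑ k ∈ Finset.Ico (n / 2) n, ((k + 1 : ℕ) : ℝ≥0∞)⁻¹ := by
      rw [← Nat.card_Ico, ← nsmul_eq_mul]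
      refine Finset.card_nsmul_le_sum _ _ _ fun k hk => ?_
      gcongr
      exact (Finset.mem_Ico.1 hk).2

theorem eLpNorm_indicator_Ico_div_le {M : ℕ} (hM : 0 < M) (n : ℕ) (q c : ℝ≥0∞) :
    eLpNorm ((Set.Ico (n / M) n).indicator fun _ => c) q harmonicMeasure ≤
      c * (M : ℝ≥0∞) ^ (1 / q.toReal) := by
  refine (eLpNorm_indicator_const_le _ _).trans ?_
  rw [enorm_eq_self]
  gcongr
  exact harmonicMeasure_Ico_div_le hM n

theorem exists_eLpNorm_add_le {α : Type*} [MeasurableSpace α] (μ : Measure α) (q : ℝ≥0∞) :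
    ∃ K : ℝ, 0 ≤ K ∧ ∀ f g : α → ℝ≥0∞, AEStronglyMeasurable f μ → AEStronglyMeasurable g μ →
      eLpNorm (f + g) q μ ≤ ENNReal.ofReal K * (eLpNorm f q μ + eLpNorm g q μ) := by
  refine ⟨q.LpAddConst.toReal, ENNReal.toReal_nonneg, fun f g hf hg => ?_⟩
  rw [ENNReal.ofReal_toReal (ENNReal.LpAddConst_lt_top q).ne]
  exact eLpNorm_add_le' hf hg q

theorem eLpNorm_le_mul_eLpNorm_of_le {f g : ℕ → ℝ≥0∞} {c : ℝ≥0∞} (h : ∀ n, f n ≤ c * g n)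
    (q : ℝ≥0∞) (μ : Measure ℕ) : eLpNorm f q μ ≤ c * eLpNorm g q μ :=
  eLpNorm_le_mul_eLpNorm_of_ae_le_mul'' q Measurable.of_discrete.aestronglyMeasurable
    (.of_forall fun n => by simpa only [enorm_eq_self] using h n)

theorem mul_eLpNorm_le_of_le {f g : ℕ → ℝ≥0∞} {c : ℝ≥0∞} (hc : c ≠ ∞)
    (h : ∀ n, c * f n ≤ g n) (q : ℝ≥0∞) (μ : Measure ℕ) : c * eLpNorm f q μ ≤ eLpNorm g q μ := by
  rcases eq_or_ne c 0 with rfl | hc0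
  · simp
  · rw [ENNReal.mul_le_iff_le_inv hc0 hc]
    exact eLpNorm_le_mul_eLpNorm_of_le (fun n => (ENNReal.mul_le_iff_le_inv hc0 hc).1 (h n)) q μ

/-- The weight `ω(1), …, ω(n)` continued by `0`, with the indices shifted by one. Its `L^q` norm for
`harmonicMeasure` is of order `ω(n)`. -/
noncomputable def truncatedWeight (ω : ℕ → ℝ) (n : ℕ) : ℕ → ℝ≥0∞ :=
  (Set.Iio n).indicator fun k => ENNReal.ofReal (ω (k + 1))

namespace IsDoublingWeight

variable {ω : ℕ → ℝ}

theorem truncatedWeight_le_add (hω : IsDoublingWeight ω) {m n : ℕ} (hmn : m ≤ n) :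
    truncatedWeight ω n ≤ truncatedWeight ω m +
      (Set.Ico m n).indicator fun _ => ENNReal.ofReal (ω n) := by
  intro k
  rcases lt_or_ge k m with hkm | hkm
  · simp [truncatedWeight, hkm, hkm.trans_le hmn]
  · by_cases hkn : k < n
    · simpa [truncatedWeight, hkm, hkn] using
        ENNReal.ofReal_le_ofReal (hω.mono (k + 1) n k.succ_pos hkn)
    · simp [truncatedWeight, hkn]

/-- The part of the weight below `n / M` is estimated by induction; if the dilation by `M` beats the
constant in the quasi-triangle inequality of `L^q`, the constants do not grow. -/
theorem exists_eLpNorm_truncatedWeight_le (hω : IsDoublingWeight ω)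
    (hi : 0 < lowerDilationIndex ω) (q : ℝ≥0∞) :
    ∃ C : ℝ, 0 < C ∧ ∀ n, 1 ≤ n →
      eLpNorm (truncatedWeight ω n) q harmonicMeasure ≤ ENNReal.ofReal (C * ω n) := by
  obtain ⟨K, hK, hadd⟩ := exists_eLpNorm_add_le harmonicMeasure q
  obtain ⟨M, hM, hdil⟩ := hω.exists_dilation_ge hi (2 * K)
  set A : ℝ := (M : ℝ) ^ (1 / q.toReal)
  refine ⟨2 * (K * A) + 1, by positivity, fun n => ?_⟩
  set C := 2 * (K * A) + 1 with hC
  induction n using Nat.strong_induction_on with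
  | _ n ih =>
    intro hn
    have hωn := hω.pos_of_one_le hn
    have hlow : ENNReal.ofReal K * eLpNorm (truncatedWeight ω (n / M)) q harmonicMeasure ≤
        ENNReal.ofReal (C / 2 * ω n) := by
      rcases (n / M).eq_zero_or_pos with h0 | h0
      · simp [h0, truncatedWeight]
      · refine (mul_le_mul_right (ih _ (Nat.div_lt_self hn hM) h0) _).trans ?_
        rw [← ENNReal.ofReal_mul hK]
        refine ENNReal.ofReal_le_ofReal ?_
        have hω2K : 2 * K * ω (n / M) ≤ ω n := (hdil _ h0).trans
          (hω.mono _ _ (Nat.mul_pos (by omega) h0) (Nat.mul_div_le n M))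
        have := mul_le_mul_of_nonneg_left hω2K (by positivity : 0 ≤ C / 2)
        linarith
    have hblock : ENNReal.ofReal K * eLpNorm ((Set.Ico (n / M) n).indicator fun _ =>
        ENNReal.ofReal (ω n)) q harmonicMeasure ≤ ENNReal.ofReal (K * (ω n * A)) := by
      rw [ENNReal.ofReal_mul hK, ENNReal.ofReal_mul hωn.le,
        ← ENNReal.ofReal_rpow_of_nonneg (by positivity) (by positivity), ENNReal.ofReal_natCast]
      gcongr
      exact eLpNorm_indicator_Ico_div_le (by omega) n q _
    calc eLpNorm (truncatedWeight ω n) q harmonicMeasure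
      _ ≤ ENNReal.ofReal (C / 2 * ω n) + ENNReal.ofReal (K * (ω n * A)) := by
        refine (eLpNorm_mono_enorm (g := truncatedWeight ω (n / M) + _) fun k =>
          hω.truncatedWeight_le_add (Nat.div_le_self n M) k).trans ?_
        refine (hadd _ _ (by fun_prop) (by fun_prop)).trans ?_
        rw [mul_add]
        exact add_le_add hlow hblock
      _ = ENNReal.ofReal (C / 2 * ω n + K * (ω n * A)) :=
        (ENNReal.ofReal_add (by positivity) (by positivity)).symm
      _ ≤ ENNReal.ofReal (C * ω n) := by
        refine ENNReal.ofReal_le_ofReal ?_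
        rw [hC]
        linarith

theorem exists_le_eLpNorm_truncatedWeight (hω : IsDoublingWeight ω) {q : ℝ≥0∞} (hq : 0 < q) :
    ∃ c : ℝ, 0 < c ∧ ∀ n, 1 ≤ n →
      ENNReal.ofReal (c * ω n) ≤ eLpNorm (truncatedWeight ω n) q harmonicMeasure := by
  obtain ⟨θ, hθ, hdbl⟩ := hω.doubling
  refine ⟨2⁻¹ ^ (1 / q.toReal) * θ⁻¹, by positivity, fun n hn => ?_⟩
  have hωn := hω.pos_of_one_le hn
  have hhalf := le_harmonicMeasure_Ico_half hn
  calc ENNReal.ofReal (2⁻¹ ^ (1 / q.toReal) * θ⁻¹ * ω n)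
    _ = ENNReal.ofReal (θ⁻¹ * ω n) * 2⁻¹ ^ (1 / q.toReal) := by
      rw [mul_assoc, mul_comm, ENNReal.ofReal_mul (by positivity),
        ← ENNReal.ofReal_rpow_of_nonneg (by positivity) (by positivity),
        ENNReal.ofReal_inv_of_pos two_pos, ENNReal.ofReal_ofNat]
    _ ≤ ENNReal.ofReal (θ⁻¹ * ω n) * harmonicMeasure (Set.Ico (n / 2) n) ^ (1 / q.toReal) := by
      gcongr
    _ = eLpNorm ((Set.Ico (n / 2) n).indicator fun _ => ENNReal.ofReal (θ⁻¹ * ω n)) q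
        harmonicMeasure := by
      rw [eLpNorm_indicator_const' measurableSet_Ico
        ((by simp : (0 : ℝ≥0∞) < 2⁻¹).trans_le hhalf).ne' hq.ne', enorm_eq_self]
    _ ≤ eLpNorm (truncatedWeight ω n) q harmonicMeasure := by
      refine eLpNorm_mono_enorm fun k => ?_
      simp only [enorm_eq_self]
      by_cases hk : k ∈ Set.Ico (n / 2) n
      · have hωk : ω n ≤ θ * ω (k + 1) :=
          (hω.mono n (2 * (k + 1)) hn (by grind)).trans (hdbl (k + 1) k.succ_pos)
        rw [Set.indicator_of_mem hk, truncatedWeight, Set.indicator_of_mem (Set.mem_Iio.2 hk.2)]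
        exact ENNReal.ofReal_le_ofReal ((inv_mul_le_iff₀ (by positivity)).2 hωk)
      · rw [Set.indicator_of_notMem hk]
        exact zero_le

end IsDoublingWeight

section ErrorQNorm

variable {X : Type*} {N : X → ℝ} {ω : ℕ → ℝ} {q : ℝ≥0∞}

theorem errorQNorm_eq_add_eLpNorm (hq : 0 < q) (E : ℕ → X → ℝ≥0∞) (x : X) :
    errorQNorm N ω q E x = ENNReal.ofReal (N x) +
      eLpNorm (fun n => ENNReal.ofReal (ω (n + 1)) * E (n + 1) x) q harmonicMeasure := by
  rw [errorQNorm]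
  split_ifs with hq'
  · have hpos : ∀ n, harmonicMeasure {n} ≠ 0 := fun n => by
      rw [← Finset.coe_singleton, harmonicMeasure_coe, Finset.sum_singleton]
      exact ENNReal.inv_ne_zero.2 (ENNReal.natCast_ne_top _)
    rw [hq', eLpNorm_exponent_top, eLpNormEssSup_eq_essSup_enorm, essSup_eq_iSup hpos]
    simp only [enorm_eq_self]
  · rw [eLpNorm_eq_lintegral_rpow_enorm_toReal hq.ne' hq', lintegral_harmonicMeasure]
    simp only [enorm_eq_self]

theorem errorQNorm_le_mul (hq : 0 < q) {E F : ℕ → X → ℝ≥0∞} {C : ℝ≥0∞} (hC : 1 ≤ C) {x : X}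
    (h : ∀ n, E (n + 1) x ≤ C * F (n + 1) x) :
    errorQNorm N ω q E x ≤ C * errorQNorm N ω q F x := by
  rw [errorQNorm_eq_add_eLpNorm hq, errorQNorm_eq_add_eLpNorm hq, mul_add]
  gcongr
  · exact le_mul_of_one_le_left' hC
  · refine eLpNorm_le_mul_eLpNorm_of_le (fun n => ?_) q _
    rw [mul_left_comm]
    gcongr
    exact h n

theorem ContEmbeds.of_le {ν μ : X → ℝ≥0∞} {C : ℝ} (hC : 0 < C)
    (h : ∀ x, μ x ≤ ENNReal.ofReal C * ν x) : ContEmbeds ν μ :=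
  ⟨fun x hx => (h x).trans_lt (ENNReal.mul_lt_top ENNReal.ofReal_lt_top hx), C, hC, fun x _ => h x⟩

theorem ofReal_mul_le_truncatedWeight_add {f : ℕ → ℝ≥0∞} {U V : ℝ≥0∞} {d n : ℕ}
    (hU : ∀ k < d, f k ≤ U) (hV : ∀ k, d ≤ k → k < n → f k ≤ V) (h0 : ∀ k, n ≤ k → f k = 0)
    (k : ℕ) :
    ENNReal.ofReal (ω (k + 1)) * f k ≤ U * truncatedWeight ω d k + V * truncatedWeight ω n k := by
  rw [mul_comm]
  rcases lt_or_ge k d with hkd | hkd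
  · refine le_add_right ?_
    rw [truncatedWeight, Set.indicator_of_mem (Set.mem_Iio.2 hkd)]
    gcongr
    exact hU k hkd
  · rcases lt_or_ge k n with hkn | hkn
    · refine le_add_left ?_
      rw [truncatedWeight, Set.indicator_of_mem (Set.mem_Iio.2 hkn)]
      gcongr
      exact hV k hkd hkn
    · rw [h0 k hkn, zero_mul]
      exact zero_le

theorem IsDoublingWeight.exists_errorQNorm_le (hω : IsDoublingWeight ω)
    (hi : 0 < lowerDilationIndex ω) (hq : 0 < q) :
    ∃ C : ℝ, 0 < C ∧ ∀ (N : X → ℝ) (E : ℕ → X → ℝ≥0∞) (x : X) (U V : ℝ) (d n : ℕ),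
      0 ≤ N x → 0 ≤ U → 0 ≤ V → 1 ≤ d → 1 ≤ n →
      (∀ k < d, E (k + 1) x ≤ ENNReal.ofReal U) →
      (∀ k, d ≤ k → k < n → E (k + 1) x ≤ ENNReal.ofReal V) →
      (∀ k, n ≤ k → E (k + 1) x = 0) →
      errorQNorm N ω q E x ≤ ENNReal.ofReal (N x + C * (U * ω d + V * ω n)) := by
  obtain ⟨C, hC, hweight⟩ := hω.exists_eLpNorm_truncatedWeight_le hi q
  obtain ⟨K, hK, hadd⟩ := exists_eLpNorm_add_le harmonicMeasure q
  refine ⟨K * C + 1, by positivity, fun N E x U V d n hNx hU hV hd hn hEU hEV hE0 => ?_⟩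
  have hωd := hω.pos_of_one_le hd
  have hωn := hω.pos_of_one_le hn
  have hscale : ∀ {A : ℝ}, 0 ≤ A → ∀ {m : ℕ}, 1 ≤ m →
      eLpNorm (fun k => ENNReal.ofReal A * truncatedWeight ω m k) q harmonicMeasure ≤
        ENNReal.ofReal (A * (C * ω m)) := fun {A} hA {m} hm => by
    rw [ENNReal.ofReal_mul hA]
    exact (eLpNorm_le_mul_eLpNorm_of_le (fun k => le_rfl) q _).trans
      (mul_le_mul_right (hweight m hm) _)
  rw [errorQNorm_eq_add_eLpNorm hq, ENNReal.ofReal_add hNx (by positivity)]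
  gcongr
  calc eLpNorm (fun k => ENNReal.ofReal (ω (k + 1)) * E (k + 1) x) q harmonicMeasure
    _ ≤ ENNReal.ofReal K * (ENNReal.ofReal (U * (C * ω d)) + ENNReal.ofReal (V * (C * ω n))) :=
      (eLpNorm_mono_enorm (ofReal_mul_le_truncatedWeight_add hEU hEV hE0 ·)).trans <|
        (hadd (fun k => ENNReal.ofReal U * truncatedWeight ω d k)
          (fun k => ENNReal.ofReal V * truncatedWeight ω n k)
          Measurable.of_discrete.aestronglyMeasurable
          Measurable.of_discrete.aestronglyMeasurable).trans
          (by gcongr <;> exact hscale ‹_› ‹_›)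
    _ = ENNReal.ofReal (K * (U * (C * ω d) + V * (C * ω n))) := by
      rw [ENNReal.ofReal_mul hK, ENNReal.ofReal_add (by positivity) (by positivity)]
    _ ≤ ENNReal.ofReal ((K * C + 1) * (U * ω d + V * ω n)) := by
      refine ENNReal.ofReal_le_ofReal ?_
      have : 0 ≤ U * ω d + V * ω n := by positivity
      linarith

theorem IsDoublingWeight.exists_le_errorQNorm (hω : IsDoublingWeight ω) (hq : 0 < q) :
    ∃ c : ℝ, 0 < c ∧ ∀ (N : X → ℝ) (E : ℕ → X → ℝ≥0∞) (x : X) (H : ℝ) (n : ℕ), 0 ≤ H → 1 ≤ n →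
      (∀ k < n, ENNReal.ofReal H ≤ E (k + 1) x) →
      ENNReal.ofReal (c * (H * ω n)) ≤ errorQNorm N ω q E x := by
  obtain ⟨c, hc, hweight⟩ := hω.exists_le_eLpNorm_truncatedWeight hq
  refine ⟨c, hc, fun N E x H n hH hn hE => ?_⟩
  have hpoint : ∀ k, ENNReal.ofReal H * truncatedWeight ω n k ≤
      ENNReal.ofReal (ω (k + 1)) * E (k + 1) x := fun k => by
    by_cases hk : k < n
    · rw [truncatedWeight, Set.indicator_of_mem (Set.mem_Iio.2 hk), mul_comm]
      gcongr
      exact hE k hk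
    · simp [truncatedWeight, hk]
  rw [errorQNorm_eq_add_eLpNorm hq, mul_left_comm, ENNReal.ofReal_mul hH]
  exact le_add_left ((mul_le_mul_right (hweight n hn) _).trans
    (mul_eLpNorm_le_of_le ENNReal.ofReal_ne_top hpoint q _))

end ErrorQNorm

end Weights

section Converse

variable {𝕜 : Type*} [RCLike 𝕜] {X : Type*} [AddCommGroup X] [Module 𝕜 X] {N : X → ℝ} {κ : ℝ}
  {e : ℕ → X} {es : ℕ → X →ₗ[𝕜] 𝕜} {ω : ℕ → ℝ} {q : ℝ≥0∞}

theorem bestTermError_le_of_card_le {m : ℕ} {S : Finset ℕ} (hS : S.card ≤ m) (b : ℕ → 𝕜) (x : X) :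
    bestTermError 𝕜 N e m x ≤ ENNReal.ofReal (N (x - ∑ n ∈ S, b n • e n)) := by
  obtain ⟨A, hSA, rfl⟩ := Infinite.exists_superset_card_eq S m hS
  have hsum : ∑ n ∈ A, (if n ∈ S then b n else 0) • e n = ∑ n ∈ S, b n • e n := by
    simp only [ite_smul, zero_smul, ← Finset.sum_filter, Finset.filter_mem_eq_inter,
      Finset.inter_eq_right.2 hSA]
  exact hsum ▸ bestTermError_le (fun n => if n ∈ S then b n else 0) x

theorem bestTermError_le_ofReal (m : ℕ) (x : X) :
    bestTermError 𝕜 N e m x ≤ ENNReal.ofReal (N x) := by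
  simpa using bestTermError_le_of_card_le (𝕜 := 𝕜) (N := N) (e := e) (S := ∅) m.zero_le 0 x

theorem IsMBasis.bestTermError_eq_zero (hN : IsQuasiNorm 𝕜 N κ) (hB : IsMBasis N e es) {m : ℕ}
    {S : Finset ℕ} (hS : S.card ≤ m) {x : X} (hx : ∀ n ∉ S, es n x = 0) :
    bestTermError 𝕜 N e m x = 0 := by
  refine le_antisymm ?_ zero_le
  have hle := bestTermError_le_of_card_le (N := N) (e := e) hS (fun n => es n (x - 0)) x
  rwa [hB.sub_sum_coeff_eq fun n hn => by rw [map_zero, hx n hn], hN.map_zero,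
    ENNReal.ofReal_zero] at hle

theorem IsMBasis.sub_basisPartialSum_eq (hB : IsMBasis N e es) {m : ℕ} {x w : X}
    (hw : ∀ n < m, es n w = 0) (hwx : ∀ n, m ≤ n → es n w = es n x) :
    x - basisPartialSum e es m x = w := by
  have hsum : basisPartialSum e es m x = ∑ n ∈ Finset.range m, es n (x - w) • e n :=
    Finset.sum_congr rfl fun n hn => by rw [map_sub, hw n (Finset.mem_range.1 hn), sub_zero]
  rw [hsum]
  exact hB.sub_sum_coeff_eq fun n hn => hwx n (by simpa using hn)

theorem IsMBasis.sub_basisPartialSum_congr (hB : IsMBasis N e es) {m : ℕ} {x y : X}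
    (hxy : ∀ n, m ≤ n → es n x = es n y) :
    x - basisPartialSum e es m x = y - basisPartialSum e es m y := by
  have hcoeff (n : ℕ) : es n (y - basisPartialSum e es m y) = if n < m then 0 else es n y := by
    rw [map_sub, basisPartialSum, hB.coeff_sum]
    simp only [Finset.mem_range]
    split_ifs <;> simp
  refine hB.sub_basisPartialSum_eq (fun n hn => ?_) fun n hn => ?_
  · rw [hcoeff, if_pos hn]
  · rw [hcoeff, if_neg hn.not_gt, hxy n hn]

/-- Approximants with coefficients in an initial segment of the basis do not affect the tail, which
in a Schauder basis is bounded by the whole vector. -/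
theorem IsSchauder.exists_le_chebyshevGreedyError (hN : IsQuasiNorm 𝕜 N κ) (hB : IsMBasis N e es)
    (hS : IsSchauder N e es) :
    ∃ c : ℝ, 0 < c ∧ ∀ (x : X) (G : Finset ℕ) (m k : ℕ), IsStrictlyGreedySet es x G → 1 ≤ m →
      (∀ n ∈ G, n < m) → k ≤ G.card →
      ENNReal.ofReal (c * N (x - basisPartialSum e es m x)) ≤ chebyshevGreedyError N e es k x := by
  obtain ⟨C, hC, hproj⟩ := hS
  have hκ := hN.pos
  refine ⟨(κ * (1 + C))⁻¹, by positivity, fun x G m k hG hm hGm hk => ?_⟩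
  obtain ⟨π, hπ⟩ := hB.exists_isGreedyOrdering hN x
  refine le_iSup₂_of_le π hπ (le_iInf fun a => ENNReal.ofReal_le_ofReal ?_)
  set y := x - ∑ i ∈ Finset.range k, a i • e (π i) with hy
  have hπm : ∀ i ∈ Finset.range k, π i < m := fun i hi => hGm _ <| by
    rw [← hπ.image_range_card hG]
    exact Finset.mem_image_of_mem π (Finset.range_mono hk hi)
  have hyx : ∀ n, m ≤ n → es n x = es n y := fun n hn => by
    rw [hy, map_sub, map_sum, Finset.sum_eq_zero fun i hi => ?_, sub_zero]
    rw [map_smul, hB.biorthogonal, if_neg ((hπm i hi).trans_le hn).ne', smul_zero]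
  rw [inv_mul_le_iff₀ (by positivity), hB.sub_basisPartialSum_congr hyx]
  calc N (y - basisPartialSum e es m y)
    _ ≤ κ * (N y + C * N y) := (hN.sub_le _ _).trans (by gcongr; exact hproj m y hm)
    _ = κ * (1 + C) * N y := by ring

/-- The vector `2 • 1_{εB} + 1_{δD}`, on which the embedding of the approximation space into the
Chebyshev-greedy class is tested. The factor `2` makes `B` a strictly greedy set. -/
def testVector (e : ℕ → X) (ε : ℕ → 𝕜) (B : Finset ℕ) (δ : ℕ → 𝕜) (D : Finset ℕ) : X :=
  (2 : 𝕜) • indicatorSum e ε B + indicatorSum e δ D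

theorem IsMBasis.coeff_testVector (hB : IsMBasis N e es) (ε δ : ℕ → 𝕜) (B D : Finset ℕ) (n : ℕ) :
    es n (testVector e ε B δ D) =
      2 * (if n ∈ B then ε n else 0) + if n ∈ D then δ n else 0 := by
  rw [testVector, map_add, map_smul, indicatorSum, indicatorSum, hB.coeff_sum, hB.coeff_sum,
    smul_eq_mul]

theorem IsMBasis.isStrictlyGreedySet_testVector (hB : IsMBasis N e es) {ε δ : ℕ → 𝕜}
    {B D : Finset ℕ} (hε : ∀ k ∈ B, ‖ε k‖ = 1) (hδ : ∀ k ∈ D, ‖δ k‖ = 1) (hBD : Disjoint B D) :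
    IsStrictlyGreedySet es (testVector e ε B δ D) B := by
  intro i hi j hj
  have hi2 : ‖es i (testVector e ε B δ D)‖ = 2 := by
    simp [hB.coeff_testVector, hi, Finset.disjoint_left.1 hBD hi, hε i hi]
  have hj1 : ‖es j (testVector e ε B δ D)‖ ≤ 1 := by
    by_cases hjD : j ∈ D <;> simp [hB.coeff_testVector, hj, hjD, hδ]
  linarith

theorem IsQuasiNorm.map_two_smul (hN : IsQuasiNorm 𝕜 N κ) (x : X) :
    N ((2 : 𝕜) • x) = 2 * N x := by
  rw [hN.smul, RCLike.norm_ofNat]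

theorem IsQuasiNorm.bestTermError_testVector_le (hN : IsQuasiNorm 𝕜 N κ) (ε δ : ℕ → 𝕜)
    {B D : Finset ℕ} {k : ℕ} (hk : D.card ≤ k) :
    bestTermError 𝕜 N e k (testVector e ε B δ D) ≤
      ENNReal.ofReal (2 * N (indicatorSum e ε B)) := by
  have hsub : testVector e ε B δ D - ∑ j ∈ D, δ j • e j = (2 : 𝕜) • indicatorSum e ε B :=
    add_sub_cancel_right _ _
  simpa only [hsub, hN.map_two_smul] using
    bestTermError_le_of_card_le (N := N) (e := e) hk δ (testVector e ε B δ D)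

theorem IsMBasis.bestTermError_testVector_eq_zero (hN : IsQuasiNorm 𝕜 N κ) (hB : IsMBasis N e es)
    (ε δ : ℕ → 𝕜) {B D : Finset ℕ} {k : ℕ} (hk : B.card + D.card ≤ k) :
    bestTermError 𝕜 N e k (testVector e ε B δ D) = 0 := by
  refine hB.bestTermError_eq_zero hN ((Finset.card_union_le B D).trans hk) fun j hj => ?_
  rw [Finset.mem_union, not_or] at hj
  simp [hB.coeff_testVector, hj]

theorem IsMBasis.exists_approxQNorm_testVector_le (hN : IsQuasiNorm 𝕜 N κ) (hB : IsMBasis N e es)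
    (hω : IsDoublingWeight ω) (hi : 0 < lowerDilationIndex ω) (hq : 0 < q) :
    ∃ C : ℝ, 0 < C ∧ ∀ (ε δ : ℕ → 𝕜) (B D : Finset ℕ), 1 ≤ D.card → D.card ≤ B.card →
      approxQNorm 𝕜 N e ω q (testVector e ε B δ D) ≤
        ENNReal.ofReal (C * (N (indicatorSum e δ D) * ω D.card +
          N (indicatorSum e ε B) * ω B.card)) := by
  obtain ⟨C, hC, hupper⟩ := hω.exists_errorQNorm_le (X := X) hi hq
  obtain ⟨θ, hθ, hdbl⟩ := hω.doubling
  have hω1 := hω.pos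
  have hκ := hN.pos
  refine ⟨2 * κ * ((ω 1)⁻¹ + C) + 2 * C * θ, by positivity, fun ε δ B D hD hDB => ?_⟩
  set x := testVector e ε B δ D
  set V := N (indicatorSum e ε B)
  set W := N (indicatorSum e δ D)
  set d := D.card
  set n := B.card
  have hV : 0 ≤ V := hN.nonneg _
  have hW : 0 ≤ W := hN.nonneg _
  have hωd := hω.pos_of_one_le hD
  have hωdn : ω d ≤ ω n := hω.mono d n hD hDB
  have hNx : N x ≤ κ * (2 * V + W) := hN.map_two_smul (indicatorSum e ε B) ▸ hN.add_le _ _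
  refine (hupper N _ x (N x) (2 * V) d (2 * n) (hN.nonneg x) (hN.nonneg x) (by positivity) hD
    (by omega) (fun k _ => bestTermError_le_ofReal _ x)
    (fun k hk _ => hN.bestTermError_testVector_le ε δ (hk.trans k.le_succ))
    (fun k hk => hB.bestTermError_testVector_eq_zero hN ε δ (by omega))).trans
    (ENNReal.ofReal_le_ofReal ?_)
  have hone : 1 ≤ (ω 1)⁻¹ * ω d := (one_le_inv_mul₀ hω1).2 (hω.mono 1 d le_rfl hD)
  calc N x + C * (N x * ω d + 2 * V * ω (2 * n))
    _ ≤ (ω 1)⁻¹ * ω d * N x + C * (N x * ω d + 2 * V * (θ * ω n)) := by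
      gcongr
      · exact le_mul_of_one_le_left (hN.nonneg x) hone
      · exact hdbl n (hD.trans hDB)
    _ = ((ω 1)⁻¹ + C) * (N x * ω d) + 2 * C * θ * (V * ω n) := by ring
    _ ≤ ((ω 1)⁻¹ + C) * (2 * κ * (W * ω d + V * ω n)) + 2 * C * θ * (W * ω d + V * ω n) := by
      have hNωd : N x * ω d ≤ 2 * κ * (W * ω d + V * ω n) := by
        have h₁ : N x * ω d ≤ κ * (2 * V + W) * ω d := mul_le_mul_of_nonneg_right hNx hωd.le
        have h₂ : κ * (V * ω d) ≤ κ * (V * ω n) := by gcongr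
        have h₃ : 0 ≤ κ * (W * ω d) := by positivity
        linarith
      gcongr
      exact le_add_of_nonneg_left (by positivity)
    _ = (2 * κ * ((ω 1)⁻¹ + C) + 2 * C * θ) * (W * ω d + V * ω n) := by ring

theorem IsSchauder.exists_le_chebyshevQNorm_testVector (hN : IsQuasiNorm 𝕜 N κ)
    (hB : IsMBasis N e es) (hS : IsSchauder N e es) (hω : IsDoublingWeight ω) (hq : 0 < q) :
    ∃ c : ℝ, 0 < c ∧ ∀ (ε δ : ℕ → 𝕜) (B D : Finset ℕ) (m : ℕ), (∀ k ∈ B, ‖ε k‖ = 1) →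
      (∀ k ∈ D, ‖δ k‖ = 1) → (∀ k ∈ B, k < m) → (∀ k ∈ D, m ≤ k) → 1 ≤ B.card →
      ENNReal.ofReal (c * (N (indicatorSum e δ D) * ω B.card)) ≤
        chebyshevQNorm N e es ω q (testVector e ε B δ D) := by
  obtain ⟨c₁, hc₁, htail⟩ := hS.exists_le_chebyshevGreedyError hN hB
  obtain ⟨c₂, hc₂, hlower⟩ := hω.exists_le_errorQNorm (X := X) hq
  refine ⟨c₂ * c₁, by positivity, fun ε δ B D m hε hδ hBm hDm hBcard => ?_⟩
  have hW : 0 ≤ N (indicatorSum e δ D) := hN.nonneg _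
  have hm : 1 ≤ m := by
    obtain ⟨k, hk⟩ := Finset.card_pos.1 hBcard
    have := hBm k hk
    omega
  have hBD : Disjoint B D := Finset.disjoint_left.2 fun k hkB hkD =>
    (hBm k hkB).not_ge (hDm k hkD)
  have hsub : testVector e ε B δ D - basisPartialSum e es m (testVector e ε B δ D) =
      indicatorSum e δ D := by
    refine hB.sub_basisPartialSum_eq (fun k hk => ?_) fun k hk => ?_
    · rw [indicatorSum, hB.coeff_sum, if_neg fun hkD => hk.not_ge (hDm k hkD)]
    · rw [hB.coeff_testVector, if_neg fun hkB => hk.not_gt (hBm k hkB), indicatorSum,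
        hB.coeff_sum, mul_zero, zero_add]
  rw [mul_assoc, ← mul_assoc c₁]
  refine hlower N _ _ _ B.card (by positivity) hBcard fun k hk => ?_
  rw [← hsub]
  exact htail _ B m (k + 1) (hB.isStrictlyGreedySet_testVector hε hδ hBD) hm hBm hk

theorem HasPropertyW.exists_indicatorSum_right_of (hN : IsQuasiNorm 𝕜 N κ) (hB : IsMBasis N e es)
    (hW : HasPropertyW 𝕜 N e) :
    ∃ C : ℝ, 0 < C ∧ ∀ (B : Finset ℕ) (d : ℕ), 1 ≤ d → ∃ (m : ℕ) (D : Finset ℕ) (δ : ℕ → 𝕜),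
      (∀ k ∈ B, k < m) ∧ (∀ k ∈ D, m ≤ k) ∧ D.card = d ∧ (∀ k ∈ D, ‖δ k‖ = 1) ∧
      realUpperDemocracy 𝕜 N e d ≤ C * N (indicatorSum e δ D) := by
  obtain ⟨C, hC, hW⟩ := hW
  refine ⟨C, hC, fun B d hd => ?_⟩
  obtain ⟨b, hb⟩ := B.bddAbove
  obtain ⟨D, δ, hDm, hDd, hδ, hle⟩ := hW d (max d (b + 1)) hd (le_max_left _ _)
  refine ⟨max d (b + 1), D, δ, fun k hk => ?_, fun k hk => Nat.lt_succ_iff.1 (hDm k hk), hDd, hδ,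
    ?_⟩
  · exact lt_max_of_lt_right (Nat.lt_succ_of_le (hb hk))
  · have hpos : 0 ≤ N (indicatorSum e δ D) := hN.nonneg _
    rwa [← hB.ofReal_realUpperDemocracy hN, ← ENNReal.ofReal_mul hC.le,
      ENNReal.ofReal_le_ofReal_iff (by positivity)] at hle

theorem HasPropertyW.exists_realUpperDemocracy_mul_le (hN : IsQuasiNorm 𝕜 N κ)
    (hB : IsMBasis N e es) (hW : HasPropertyW 𝕜 N e) (hS : IsSchauder N e es)
    (hω : IsDoublingWeight ω) (hi : 0 < lowerDilationIndex ω) (hq : 0 < q)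
    (hemb : ContEmbeds (approxQNorm 𝕜 N e ω q) (chebyshevQNorm N e es ω q)) :
    ∃ R : ℝ, 0 < R ∧ ∀ (B : Finset ℕ) (ε : ℕ → 𝕜) (d : ℕ), (∀ k ∈ B, ‖ε k‖ = 1) → 1 ≤ d →
      d ≤ B.card → realUpperDemocracy 𝕜 N e d * ω B.card ≤
        R * (realUpperDemocracy 𝕜 N e d * ω d + N (indicatorSum e ε B) * ω B.card) := by
  obtain ⟨Cw, hCw, hright⟩ := hW.exists_indicatorSum_right_of hN hB
  obtain ⟨C, hC, hupper⟩ := hB.exists_approxQNorm_testVector_le hN hω hi hq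
  obtain ⟨c, hc, hlower⟩ := hS.exists_le_chebyshevQNorm_testVector hN hB hω hq
  obtain ⟨-, Ce, hCe, hemb⟩ := hemb
  refine ⟨Cw * c⁻¹ * (Ce * C), by positivity, fun B ε d hε hd hdB => ?_⟩
  obtain ⟨m, D, δ, hBm, hDm, rfl, hδ, hle⟩ := hright B d hd
  have hDle : N (indicatorSum e δ D) ≤ realUpperDemocracy 𝕜 N e D.card :=
    hB.indicatorSum_le hN le_rfl hδ
  set h := realUpperDemocracy 𝕜 N e D.card
  set V := N (indicatorSum e ε B)
  set W := N (indicatorSum e δ D)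
  have hV : 0 ≤ V := hN.nonneg _
  have hW : 0 ≤ W := hN.nonneg _
  have hωd := hω.pos_of_one_le hd
  have hωn := hω.pos_of_one_le (hd.trans hdB)
  have htest : c * (W * ω B.card) ≤ Ce * (C * (W * ω D.card + V * ω B.card)) := by
    rw [← ENNReal.ofReal_le_ofReal_iff (by positivity), ENNReal.ofReal_mul hCe.le]
    refine (hlower ε δ B D m hε hδ hBm hDm (hd.trans hdB)).trans ?_
    have hle := hupper ε δ B D hd hdB
    exact (hemb _ (hle.trans_lt ENNReal.ofReal_lt_top)).trans (mul_le_mul_right hle _)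
  calc h * ω B.card
    _ ≤ Cw * W * ω B.card := by gcongr
    _ = Cw * c⁻¹ * (c * (W * ω B.card)) := by field_simp
    _ ≤ Cw * c⁻¹ * (Ce * (C * (W * ω D.card + V * ω B.card))) := by gcongr
    _ ≤ Cw * c⁻¹ * (Ce * (C * (h * ω D.card + V * ω B.card))) := by gcongr
    _ = Cw * c⁻¹ * (Ce * C) * (h * ω D.card + V * ω B.card) := by ring

/-- With `d = |B| / M`, the weight grows enough from `d` to `|B|` for the term `h_r(d) ω(d)` in the
preceding bound to be absorbed. -/
theorem HasPropertyW.exists_realUpperDemocracy_div_le (hN : IsQuasiNorm 𝕜 N κ)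
    (hB : IsMBasis N e es) (hW : HasPropertyW 𝕜 N e) (hS : IsSchauder N e es)
    (hω : IsDoublingWeight ω) (hi : 0 < lowerDilationIndex ω) (hq : 0 < q)
    (hemb : ContEmbeds (approxQNorm 𝕜 N e ω q) (chebyshevQNorm N e es ω q)) :
    ∃ (M : ℕ) (R : ℝ), 0 < M ∧ 0 < R ∧ ∀ (B : Finset ℕ) (ε : ℕ → 𝕜), (∀ k ∈ B, ‖ε k‖ = 1) →
      M ≤ B.card → realUpperDemocracy 𝕜 N e (B.card / M) ≤ R * N (indicatorSum e ε B) := by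
  obtain ⟨R, hR, hbound⟩ := hW.exists_realUpperDemocracy_mul_le hN hB hS hω hi hq hemb
  obtain ⟨M, hM, hdil⟩ := hω.exists_dilation_ge hi (2 * R)
  have hM0 : 0 < M := by omega
  refine ⟨M, 2 * R, hM0, by positivity, fun B ε hε hBM => ?_⟩
  have hd : 1 ≤ B.card / M := Nat.div_pos hBM hM0
  have hdB : B.card / M ≤ B.card := Nat.div_le_self _ _
  have hωd : 2 * R * ω (B.card / M) ≤ ω B.card := (hdil _ hd).trans
    (hω.mono _ _ (Nat.mul_pos hM0 hd) (Nat.mul_div_le _ M))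
  have hhωd := mul_le_mul_of_nonneg_left hωd
    (realUpperDemocracy_nonneg (𝕜 := 𝕜) (N := N) (e := e) (B.card / M))
  refine le_of_mul_le_mul_right ?_ (hω.pos_of_one_le (hd.trans hdB))
  linarith [hbound B ε _ hε hd hdB]

theorem IsMBasis.exists_one_le_mul_indicatorSum (hN : IsQuasiNorm 𝕜 N κ) (hB : IsMBasis N e es) :
    ∃ c : ℝ, 0 < c ∧ ∀ (B : Finset ℕ) (ε : ℕ → 𝕜), B.Nonempty → (∀ k ∈ B, ‖ε k‖ = 1) →
      1 ≤ c * N (indicatorSum e ε B) := by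
  obtain ⟨c, hc, -, hes⟩ := hB.exists_bound hN
  refine ⟨c, hc, fun B ε ⟨k, hk⟩ hε => ?_⟩
  have hcoeff : es k (indicatorSum e ε B) = ε k := by
    rw [indicatorSum, hB.coeff_sum, if_pos hk]
  simpa only [hcoeff, hε k hk] using hes k (indicatorSum e ε B)

theorem HasPropertyW.isSuperDemocratic (hN : IsQuasiNorm 𝕜 N κ) (hB : IsMBasis N e es)
    (hW : HasPropertyW 𝕜 N e) (hS : IsSchauder N e es) (hω : IsDoublingWeight ω)
    (hi : 0 < lowerDilationIndex ω) (hq : 0 < q)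
    (hemb : ContEmbeds (approxQNorm 𝕜 N e ω q) (chebyshevQNorm N e es ω q)) :
    IsSuperDemocratic 𝕜 N e := by
  obtain ⟨M, R, hM, hR, hdiv⟩ := hW.exists_realUpperDemocracy_div_le hN hB hS hω hi hq hemb
  obtain ⟨c, hc, hone⟩ := hB.exists_one_le_mul_indicatorSum hN
  have hκ := hN.pos
  set h := realUpperDemocracy 𝕜 N e
  have hhM : 0 ≤ h M := realUpperDemocracy_nonneg M
  have hmono : Monotone h := hB.realUpperDemocracy_mono hN
  refine ⟨(2 * κ) ^ (2 * M) * R + h M * c, by positivity, fun B ε hε => ?_⟩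
  set V := N (indicatorSum e ε B)
  have hV : 0 ≤ V := hN.nonneg _
  have hlarge : 0 ≤ (2 * κ) ^ (2 * M) * R * V := by positivity
  have hsmall : 0 ≤ h M * c * V := by positivity
  rw [add_mul]
  rcases B.eq_empty_or_nonempty with rfl | hBne
  · rw [Finset.card_empty, realUpperDemocracy_zero hN]
    positivity
  rcases lt_or_ge B.card M with hBM | hBM
  · calc h B.card
      _ ≤ h M := hmono hBM.le
      _ ≤ h M * (c * V) := le_mul_of_one_le_right hhM (hone B ε hBne hε)
      _ ≤ _ := by linarith
  · have hcard : B.card ≤ 2 * M * (B.card / M) := by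
      have hlt : B.card < M * (B.card / M + 1) := Nat.lt_mul_div_succ _ hM
      have hpos : 1 ≤ B.card / M := Nat.div_pos hBM hM
      nlinarith
    calc h B.card
      _ ≤ h (2 * M * (B.card / M)) := hmono hcard
      _ ≤ (2 * κ) ^ (2 * M) * h (B.card / M) := hB.realUpperDemocracy_mul_le hN _ _
      _ ≤ (2 * κ) ^ (2 * M) * (R * V) := by
        gcongr
        exact hdiv B ε hε hBM
      _ ≤ _ := by linarith

end Converse

theorem IsSemiGreedy.contEmbeds {𝕜 : Type*} [RCLike 𝕜] {X : Type*} [AddCommGroup X] [Module 𝕜 X]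
    {N : X → ℝ} {e : ℕ → X} {es : ℕ → X →ₗ[𝕜] 𝕜} (hsg : IsSemiGreedy N e es) (ω : ℕ → ℝ)
    {q : ℝ≥0∞} (hq : 0 < q) :
    ContEmbeds (approxQNorm 𝕜 N e ω q) (chebyshevQNorm N e es ω q) := by
  obtain ⟨C, -, hsg⟩ := hsg
  refine ContEmbeds.of_le (C := max C 1) (by positivity) fun x => ?_
  refine errorQNorm_le_mul hq (ENNReal.one_le_ofReal.2 (le_max_right C 1)) fun n => ?_
  refine (hsg (n + 1) x n.succ_pos).trans ?_
  gcongr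
  exact le_max_left C 1

theorem IsMBasis.contEmbeds {𝕜 : Type*} [RCLike 𝕜] {X : Type*} [AddCommGroup X] [Module 𝕜 X]
    {N : X → ℝ} {κ : ℝ} {e : ℕ → X} {es : ℕ → X →ₗ[𝕜] 𝕜} (hN : IsQuasiNorm 𝕜 N κ)
    (hB : IsMBasis N e es) (ω : ℕ → ℝ) {q : ℝ≥0∞} (hq : 0 < q) :
    ContEmbeds (chebyshevQNorm N e es ω q) (approxQNorm 𝕜 N e ω q) := by
  refine ContEmbeds.of_le one_pos fun x => ?_
  rw [ENNReal.ofReal_one]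
  refine errorQNorm_le_mul hq le_rfl fun n => ?_
  rw [one_mul]
  exact hB.bestTermError_le_chebyshevGreedyError hN (n + 1) x

theorem theorem1p3_general {𝕜 : Type*} [RCLike 𝕜] {X : Type*} [AddCommGroup X] [Module 𝕜 X]
    {N : X → ℝ} {κ : ℝ} (hN : IsQuasiNorm 𝕜 N κ) {e : ℕ → X} {es : ℕ → X →ₗ[𝕜] 𝕜}
    (hB : IsMBasis N e es) :
    (IsSemiGreedy N e es → ∀ (ω : ℕ → ℝ) (q : ℝ≥0∞), 0 < q →
      ClassesEquiv (approxQNorm 𝕜 N e ω q) (chebyshevQNorm N e es ω q)) ∧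
    (IsQuasiGreedy N e es → IsSchauder N e es → HasPropertyW 𝕜 N e → ∀ ω : ℕ → ℝ,
      IsDoublingWeight ω → 0 < lowerDilationIndex ω →
      (∃ q : ℝ≥0∞, 0 < q ∧
        ContEmbeds (approxQNorm 𝕜 N e ω q) (chebyshevQNorm N e es ω q)) →
      IsSemiGreedy N e es) := by
  refine ⟨fun hsg ω q hq => ⟨hsg.contEmbeds ω hq, hB.contEmbeds hN ω hq⟩, ?_⟩
  rintro hqg hS hW ω hω hi ⟨q, hq, hemb⟩
  exact (hW.isSuperDemocratic hN hB hS hω hi hq hemb).isSemiGreedy hN hB hqg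

theorem theorem1p3 {𝕜 : Type*} [RCLike 𝕜] {X : Type*} [AddCommGroup X] [Module 𝕜 X]
    (N : X → ℝ) (hN : IsQuasiBanach 𝕜 N)
    (e : ℕ → X) (es : ℕ → X →ₗ[𝕜] 𝕜) (hB : IsMBasis N e es) (hqg : IsQuasiGreedy N e es)
    (ω : ℕ → ℝ) (hω : IsDoublingWeight ω) (hi : 0 < lowerDilationIndex ω) :
    (IsSemiGreedy N e es → ∀ q : ℝ≥0∞, 0 < q →
      ClassesEquiv (approxQNorm 𝕜 N e ω q) (chebyshevQNorm N e es ω q)) ∧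
    (IsSchauder N e es → HasPropertyW 𝕜 N e →
      (∃ q : ℝ≥0∞, 0 < q ∧
        ClassesEquiv (approxQNorm 𝕜 N e ω q) (chebyshevQNorm N e es ω q)) →
      IsSemiGreedy N e es) := by
  obtain ⟨κ, hN⟩ := hN.exists_isQuasiNorm
  obtain ⟨hsg, hconv⟩ := theorem1p3_general hN hB
  exact ⟨fun h => hsg h ω, fun hS hW ⟨q, hq, hemb⟩ => hconv hqg hS hW ω hω hi ⟨q, hq, hemb.1⟩⟩
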